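/- Setting. Let $\mathcal M$ be a von Neumann algebra with a normal faithful normalized trace $\tau$, and let $(\mathcal M_n)_{n\ge 1}$ be an increasing sequence of von Neumann subalgebras of $\mathcal M$ whose union is w*-dense in $\mathcal M$. Let $L^p(\mathcal M)$ ($p=1,2$) be the non-commutative $L^p$-space of $(\mathcal M,\tau)$, i.e. the completion of $\mathcal M$ for $\|a\|_p=\tau(|a|^p)^{1/p}$, $|a|=(a^*a)^{1/2}$, and let $\mathcal E_n:L^1(\mathcal M)\to L^1(\mathcal M_n)$ be the $\tau$-preserving conditional expectation. A martingale is a sequence $x=(x_n)_{n\ge1}$ in $L^1(\mathcal M)$ with $x_n=\mathcal E_n(x_{n+1})$ for all $n\ge 1$; put $dx_n=x_n-x_{n-1}$, with $x_0=0$. The Hardy space $\mathcal H^1$ consists of the martingales $x$ with $$\|x\|_{\mathcal H^1}=\inf\Bigl\{\Bigl\|\Bigl(\sum_{n\ge1}|dy_n|^2\Bigr)^{1/2}\Bigr\|_1+\Bigl\|\Bigl(\sum_{n\ge1}|dz_n^*|^2\Bigr)^{1/2}\Bigr\|_1\Bigr\}<\infty,$$ the infimum being over all decompositions $x=y+z$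 into two martingales. The Hardy space $\mathcal H^1_{\max}$ consists of the martingales $x$ with $$\|x\|_{\mathcal H^1_{\max}}=\inf\ \|a\|_2\,\sup_n\|y_n\|_\infty\,\|b\|_2<\infty,$$ the infimum being over all $a,b\in L^2(\mathcal M)$ and all bounded sequences $(y_n)$ in $\mathcal M$ with $x_n=ay_nb$ for all $n$. Corollary 10. In general the spaces $\mathcal H^1$ and $\mathcal H^1_{\max}$ do not coincide. More precisely, there are $\mathcal M$, $\tau$ and $(\mathcal M_n)_{n\ge1}$ as above such that $\mathcal H^1\not\subset\mathcal H^1_{\max}$. -/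

import Mathlib

open scoped ComplexOrder ENNReal InnerProductSpace

namespace VonNeumannAlgebra

variable {H : Type*} [NormedAddCommGroup H] [InnerProductSpace ℂ H] [CompleteSpace H]

instance instSMulMemClass : SMulMemClass (VonNeumannAlgebra H) ℂ (H →L[ℂ] H) where
  smul_mem {S} c _ hx := S.toStarSubalgebra.smul_mem hx c

theorem isClosed_coe (M : VonNeumannAlgebra H) : IsClosed (M : Set (H →L[ℂ] H)) := by
  rw [← M.centralizer_centralizer]
  exact Set.isClosed_centralizer _

instance instIsClosed (M : VonNeumannAlgebra H) : IsClosed (M : Set (H →L[ℂ] H)) :=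
  M.isClosed_coe

noncomputable instance instCStarAlgebra (M : VonNeumannAlgebra H) : CStarAlgebra M :=
  StarSubalgebra.cstarAlgebra M

instance (M : VonNeumannAlgebra H) : StarOrderedRing M := by
  refine StarOrderedRing.of_nonneg_iff' (fun {x y} hxy z => ?_) (fun x => ⟨fun hx => ?_, ?_⟩)
  · have h : (x : H →L[ℂ] H) ≤ y := hxy
    show ((z + x : M) : H →L[ℂ] H) ≤ ((z + y : M) : H →L[ℂ] H)
    push_cast
    gcongr
  · have h : (0 : H →L[ℂ] H) ≤ x := hx
    have hs : cfc (fun t : ℝ => √t) (x : H →L[ℂ] H) ∈ M := cfc_mem (𝕜' := ℂ) _ x.2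
    have hsa : star (cfc (fun t : ℝ => √t) (x : H →L[ℂ] H)) = cfc (fun t : ℝ => √t) (x : H →L[ℂ] H) :=
      cfc_predicate (R := ℝ) (p := IsSelfAdjoint) _ (x : H →L[ℂ] H)
    refine ⟨⟨_, hs⟩, Subtype.ext ?_⟩
    have hx' : IsSelfAdjoint (x : H →L[ℂ] H) := .of_nonneg h
    change (x : H →L[ℂ] H) = star (cfc (fun t : ℝ => √t) (x : H →L[ℂ] H)) * cfc (fun t : ℝ => √t) (x : H →L[ℂ] H)
    rw [hsa, ← cfc_mul _ _ (x : H →L[ℂ] H)]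
    conv_lhs => rw [← cfc_id' ℝ (x : H →L[ℂ] H)]
    exact cfc_congr fun t ht => (Real.mul_self_sqrt (spectrum_nonneg_of_nonneg h ht)).symm
  · rintro ⟨s, rfl⟩
    exact star_mul_self_nonneg (s : H →L[ℂ] H)
end VonNeumannAlgebra

namespace NCMartingale

section Trace

theorem sum_conj {B : Type*} [CStarAlgebra B] {ι : Type*} [Fintype ι] (a : ι → B) (r : B) :
    ∑ i, star (a i * r) * (a i * r) = star r * (∑ i, star (a i) * a i) * r := by
  rw [Finset.mul_sum, Finset.sum_mul]
  exact Finset.sum_congr rfl fun i _ => by simp only [star_mul, mul_assoc]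

variable {A : Type*} [CStarAlgebra A] [PartialOrder A] [StarOrderedRing A]

theorem exists_approx (h : A) (hh : 0 ≤ h) (ε : ℝ) (hε : 0 < ε) :
    ∃ q r : A, star q = q ∧ star r = r ∧ q * r = 1 ∧ r * q = 1 ∧
      q * q = h + algebraMap ℝ A ε ∧ r * (h * h) * r ≤ q * q ∧
      (r * r) * (h * h) * (r * r) ≤ 1 ∧ h - algebraMap ℝ A ε ≤ (r * r) * (h * h) := by
  have hsa : IsSelfAdjoint h := .of_nonneg hh
  have hpos : ∀ x : ℝ, 0 < |x| + ε := fun x => by positivity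
  have hne : ∀ x : ℝ, √(|x| + ε) ≠ 0 := fun x => (Real.sqrt_pos.2 (hpos x)).ne'
  have hc : Continuous fun x : ℝ => √(|x| + ε) := by fun_prop
  have hc' : Continuous fun x : ℝ => (√(|x| + ε))⁻¹ := hc.inv₀ hne
  have hcc : Continuous fun x : ℝ => (|x| + ε)⁻¹ :=
    Continuous.inv₀ (by fun_prop) fun x => (hpos x).ne'
  have hx2 : Continuous fun x : ℝ => x * x := by fun_prop
  have hspec : ∀ x ∈ spectrum ℝ h, 0 ≤ x := fun x hx => spectrum_nonneg_of_nonneg hh hx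
  have hm : ∀ f g : ℝ → ℝ, Continuous f → Continuous g →
      cfc f h * cfc g h = cfc (fun x => f x * g x) h := fun f g hf hg =>
    (cfc_mul f g h hf.continuousOn hg.continuousOn).symm
  have hle : ∀ f g : ℝ → ℝ, Continuous f → Continuous g → (∀ x, 0 ≤ x → f x ≤ g x) →
      cfc f h ≤ cfc g h := fun f g hf hg H =>
    cfc_mono (fun x hx => H x (hspec x hx)) hf.continuousOn hg.continuousOn
  have hone : (1 : A) = cfc (fun _ : ℝ => (1 : ℝ)) h := (cfc_const_one ℝ h).symm
  set q := cfc (fun x : ℝ => √(|x| + ε)) h with hq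
  set r := cfc (fun x : ℝ => (√(|x| + ε))⁻¹) h with hr
  have hqq : q * q = cfc (fun x : ℝ => x + ε) h := by
    rw [hq, hm _ _ hc hc]
    refine cfc_congr fun x hx => ?_
    rw [Real.mul_self_sqrt (hpos x).le, abs_of_nonneg (hspec x hx)]
  have hh2 : h * h = cfc (fun x : ℝ => x * x) h := by
    rw [← hm _ _ continuous_id' continuous_id', cfc_id' ℝ h]
  have hrr : r * r = cfc (fun x : ℝ => (|x| + ε)⁻¹) h := by
    rw [hr, hm _ _ hc' hc']
    refine cfc_congr fun x hx => ?_
    rw [← mul_inv, Real.mul_self_sqrt (hpos x).le]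
  refine ⟨q, r, cfc_predicate (R := ℝ) (p := IsSelfAdjoint) _ h,
    cfc_predicate (R := ℝ) (p := IsSelfAdjoint) _ h, ?_, ?_, ?_, ?_, ?_, ?_⟩
  · rw [hq, hr, hm _ _ hc hc', hone]
    exact cfc_congr fun x _ => mul_inv_cancel₀ (hne x)
  · rw [hq, hr, hm _ _ hc' hc, hone]
    exact cfc_congr fun x _ => inv_mul_cancel₀ (hne x)
  · rw [hqq, cfc_add_const ε (fun x : ℝ => x) h, cfc_id' ℝ h]
  · rw [hqq, hh2, hr, hm _ _ hc' hx2,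
      hm (fun x => (√(|x| + ε))⁻¹ * (x * x)) _ (hc'.mul hx2) hc']
    refine hle _ _ ((hc'.mul hx2).mul hc') (by fun_prop) fun x h0 => ?_
    rw [mul_right_comm, ← mul_inv, Real.mul_self_sqrt (hpos x).le, abs_of_nonneg h0,
      inv_mul_le_iff₀ (by positivity)]
    nlinarith
  · rw [hrr, hh2, hm _ _ hcc hx2,
      hm (fun x => (|x| + ε)⁻¹ * (x * x)) _ (hcc.mul hx2) hcc, hone]
    refine hle _ _ ((hcc.mul hx2).mul hcc) (by fun_prop) fun x h0 => ?_
    rw [mul_right_comm, ← mul_inv, abs_of_nonneg h0, inv_mul_le_iff₀ (by positivity)]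
    nlinarith
  · have : h - algebraMap ℝ A ε = cfc (fun x : ℝ => x - ε) h := by
      rw [cfc_sub (fun x : ℝ => x) (fun _ => ε) h, cfc_id' ℝ h, cfc_const ε h]
    rw [this, hrr, hh2, hm _ _ hcc (by fun_prop)]
    refine hle _ _ (by fun_prop) (hcc.mul hx2) fun x h0 => ?_
    rw [abs_of_nonneg h0, le_inv_mul_iff₀ (by positivity)]
    nlinarith
/-- A normal faithful normalized (finite) trace. -/
structure NormalTrace (A : Type*) [CStarAlgebra A] [PartialOrder A] [StarOrderedRing A] where
  /-- the underlying positive linear functional -/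
  tr : A →ₚ[ℂ] ℂ
  tr_one : tr 1 = 1
  tr_mul_comm : ∀ a b, tr (a * b) = tr (b * a)
  faithful : ∀ a, tr (star a * a) = 0 → a = 0
  normal : ∀ (S : Set A) (s : A), S.Nonempty → DirectedOn (· ≤ ·) S → (∀ a ∈ S, 0 ≤ a) →
    IsLUB S s → IsLUB ((fun a => (tr a).re) '' S) (tr s).re

namespace NormalTrace

variable (τ : NormalTrace A)

theorem re_mono {a b : A} (h : a ≤ b) : (τ.tr a).re ≤ (τ.tr b).re :=
  (Complex.le_def.1 (OrderHomClass.mono τ.tr h)).1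

theorem re_nonneg {a : A} (h : 0 ≤ a) : 0 ≤ (τ.tr a).re := by
  simpa using τ.re_mono h

theorem tr_star (a : A) : τ.tr (star a) = star (τ.tr a) := map_star τ.tr a

theorem tr_algebraMap (r : ℝ) : (τ.tr (algebraMap ℝ A r)).re = r := by
  have : algebraMap ℝ A r = (r : ℂ) • (1 : A) := by
    rw [Algebra.algebraMap_eq_smul_one, Complex.coe_smul]
  rw [this, map_smul, τ.tr_one]; simp

theorem two_re_le (x y : A) :
    2 * (τ.tr (star x * y)).re ≤ (τ.tr (star x * x)).re + (τ.tr (star y * y)).re := by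
  have h := τ.re_nonneg (star_mul_self_nonneg (x - y))
  have e : star (x - y) * (x - y) = star x * x + star y * y - star x * y - star (star x * y) := by
    simp only [star_sub, star_mul, star_star]; noncomm_ring
  rw [e] at h
  simp only [map_sub, map_add, τ.tr_star, Complex.sub_re, Complex.add_re, Complex.star_def,
    Complex.conj_re] at h
  linarith

variable {ι : Type*} [Fintype ι]

/-- The norm `‖(∑ |aᵢ|²)^{1/2}‖₁ = τ((∑ |aᵢ|²)^{1/2})` of a finite family of elements of `A`. -/
noncomputable def colNorm (a : ι → A) : ℝ := (τ.tr (CFC.sqrt (∑ i, star (a i) * a i))).re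

theorem sum_nonneg (a : ι → A) : 0 ≤ ∑ i, star (a i) * a i :=
  Finset.sum_nonneg fun i _ => star_mul_self_nonneg (a i)

theorem colNorm_nonneg (a : ι → A) : 0 ≤ τ.colNorm a := τ.re_nonneg (CFC.sqrt_nonneg _)

theorem re_dual_le (a c : ι → A) (hc : ∑ i, star (c i) * c i ≤ 1) :
    (τ.tr (∑ i, star (c i) * a i)).re ≤ τ.colNorm a := by
  refine le_of_forall_pos_le_add fun ε hε => ?_
  set s := ∑ i, star (a i) * a i with hs
  obtain ⟨q, r, hq, hr, hqr, hrq, hqq, h1, -, -⟩ :=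
    exists_approx (CFC.sqrt s) (CFC.sqrt_nonneg _) ε hε
  rw [CFC.sqrt_mul_sqrt_self s (sum_nonneg a)] at h1
  have e : ∀ i, τ.tr (star (c i) * a i) = τ.tr (star (c i * q) * (a i * r)) := fun i => by
    rw [star_mul, hq, mul_assoc q, τ.tr_mul_comm q, ← mul_assoc, mul_assoc _ r q, hrq, mul_one]
  have hk : (τ.tr (q * q)).re = τ.colNorm a + ε := by
    rw [hqq, map_add, Complex.add_re, τ.tr_algebraMap]; rfl
  have h2 : 2 * (τ.tr (∑ i, star (c i) * a i)).re ≤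
      (τ.tr (∑ i, star (c i * q) * (c i * q))).re +
        (τ.tr (∑ i, star (a i * r) * (a i * r))).re := by
    simp only [map_sum, Complex.re_sum, Finset.mul_sum, ← Finset.sum_add_distrib, e]
    exact Finset.sum_le_sum fun i _ => τ.two_re_le _ _
  rw [sum_conj, sum_conj, hq, hr, ← hs] at h2
  have h3 := τ.re_mono h1
  have h4 : q * (∑ i, star (c i) * c i) * q ≤ q * q := by
    have := star_left_conjugate_le_conjugate hc q
    rwa [hq, mul_one] at this
  have h5 := τ.re_mono h4
  linarith

theorem norm_dual_le (a c : ι → A) (hc : ∑ i, star (c i) * c i ≤ 1) :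
    ‖τ.tr (∑ i, star (c i) * a i)‖ ≤ τ.colNorm a := by
  set z := τ.tr (∑ i, star (c i) * a i) with hz
  by_cases h0 : z = 0
  · rw [h0, norm_zero]; exact τ.colNorm_nonneg a
  have hn : ‖z‖ ≠ 0 := norm_ne_zero_iff.2 h0
  set u : ℂ := z / ‖z‖ with hu
  have huu : star u * u = 1 := by
    have : ‖u‖ = 1 := by rw [hu, norm_div, Complex.norm_real, norm_norm, div_self hn]
    rw [Complex.star_def, ← Complex.normSq_eq_conj_mul_self, Complex.normSq_eq_norm_sq, this]; simp
  have hzu : star u * z = ‖z‖ := by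
    have : z = ‖z‖ * u := by rw [hu]; field_simp
    calc star u * z = star u * (‖z‖ * u) := by rw [← this]
      _ = ‖z‖ * (star u * u) := by ring
      _ = ‖z‖ := by rw [huu, mul_one]
  have h := τ.re_dual_le a (fun i => u • c i) (by
    simpa only [star_smul, smul_mul_smul_comm, huu, one_smul] using hc)
  simp only [star_smul, smul_mul_assoc, ← Finset.smul_sum, map_smul, smul_eq_mul, ← hz] at h
  rwa [hzu, Complex.ofReal_re] at h

theorem exists_dual (a : ι → A) (ε : ℝ) (hε : 0 < ε) :
    ∃ c : ι → A, ∑ i, star (c i) * c i ≤ 1 ∧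
      τ.colNorm a ≤ (τ.tr (∑ i, star (c i) * a i)).re + ε := by
  set s := ∑ i, star (a i) * a i with hs
  obtain ⟨q, r, hq, hr, hqr, hrq, hqq, -, h1, h2⟩ :=
    exists_approx (CFC.sqrt s) (CFC.sqrt_nonneg _) ε hε
  rw [CFC.sqrt_mul_sqrt_self s (sum_nonneg a)] at h1 h2
  refine ⟨fun i => a i * (r * r), ?_, ?_⟩
  · rw [sum_conj, star_mul, hr]; exact h1
  · have h3 := τ.re_mono h2
    rw [map_sub, Complex.sub_re, τ.tr_algebraMap] at h3
    simp only [star_mul, hr, mul_assoc, ← Finset.mul_sum]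
    rw [← mul_assoc, ← hs]
    change _ - ε ≤ _ at h3
    unfold colNorm
    linarith

theorem colNorm_add_le (a b : ι → A) : τ.colNorm (a + b) ≤ τ.colNorm a + τ.colNorm b := by
  refine le_of_forall_pos_le_add fun ε hε => ?_
  obtain ⟨c, hc, h⟩ := τ.exists_dual (a + b) ε hε
  have h1 := τ.re_dual_le a c hc
  have h2 := τ.re_dual_le b c hc
  simp only [Pi.add_apply, mul_add, Finset.sum_add_distrib, map_add, Complex.add_re] at h
  linarith

theorem colNorm_neg (a : ι → A) : τ.colNorm (-a) = τ.colNorm a := by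
  simp [colNorm]

/-- The norm `‖a‖₁ = τ(|a|)`. -/
noncomputable def norm₁ (a : A) : ℝ := (τ.tr (CFC.abs a)).re

theorem norm₁_eq (a : A) : τ.norm₁ a = τ.colNorm (fun _ : Unit => a) := by
  simp [norm₁, colNorm, CFC.abs]

theorem norm₁_nonneg (a : A) : 0 ≤ τ.norm₁ a := τ.re_nonneg (CFC.abs_nonneg a)

theorem norm₁_add_le (a b : A) : τ.norm₁ (a + b) ≤ τ.norm₁ a + τ.norm₁ b := by
  simp only [norm₁_eq]; exact τ.colNorm_add_le _ _

theorem norm₁_smul (z : ℂ) (a : A) : τ.norm₁ (z • a) = ‖z‖ * τ.norm₁ a := by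
  simp only [norm₁, CFC.abs_smul]
  rw [← Complex.coe_smul, map_smul, smul_eq_mul, Complex.re_ofReal_mul]

theorem star_mul_self_le_one {c : A} (hc : ‖c‖ ≤ 1) : star c * c ≤ 1 := by
  have := CStarAlgebra.star_mul_le_algebraMap_norm_sq (a := c)
  refine this.trans ?_
  rw [← map_one (algebraMap ℝ A)]
  exact algebraMap_mono A (by nlinarith [norm_nonneg c])

theorem norm_tr_mul_le_of_le_one (a c : A) (hc : ‖c‖ ≤ 1) : ‖τ.tr (c * a)‖ ≤ τ.norm₁ a := by
  have := τ.norm_dual_le (fun _ : Unit => a) (fun _ => star c) (by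
    simpa using star_mul_self_le_one (c := star c) (by simpa using hc))
  simpa [norm₁_eq] using this

theorem norm_tr_mul_le (a c : A) : ‖τ.tr (c * a)‖ ≤ ‖c‖ * τ.norm₁ a := by
  by_cases h0 : c = 0
  · simp [h0]
  have hn : 0 < ‖c‖ := norm_pos_iff.2 h0
  have h := τ.norm_tr_mul_le_of_le_one a (((‖c‖⁻¹ : ℝ) : ℂ) • c) (by
    rw [norm_smul, Complex.norm_real, norm_inv, norm_norm, inv_mul_cancel₀ hn.ne'])
  rw [smul_mul_assoc, map_smul, norm_smul, Complex.norm_real, norm_inv, norm_norm,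
    inv_mul_le_iff₀ hn] at h
  exact h

theorem norm_le_one_of_sum {c : ι → A} (hc : ∑ i, star (c i) * c i ≤ 1) (i : ι) : ‖c i‖ ≤ 1 := by
  have h1 : star (c i) * c i ≤ 1 :=
    (Finset.single_le_sum (f := fun j => star (c j) * c j)
      (fun j _ => star_mul_self_nonneg (c j)) (Finset.mem_univ i)).trans hc
  have h2 := (CStarAlgebra.norm_le_one_iff_of_nonneg (star (c i) * c i)
    (star_mul_self_nonneg _)).2 h1
  rw [CStarRing.norm_star_mul_self] at h2
  nlinarith [norm_nonneg (c i)]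

theorem norm₁_star (a : A) : τ.norm₁ (star a) = τ.norm₁ a := by
  suffices H : ∀ b : A, τ.norm₁ (star b) ≤ τ.norm₁ b from
    le_antisymm (H a) (by simpa using H (star a))
  intro b
  refine le_of_forall_pos_le_add fun ε hε => ?_
  obtain ⟨c, hc, h⟩ := τ.exists_dual (fun _ : Unit => star b) ε hε
  rw [← norm₁_eq, Fintype.sum_unique] at h
  have hc' : ‖c ()‖ ≤ 1 := norm_le_one_of_sum hc ()
  have h3 := τ.norm_tr_mul_le_of_le_one b (c ()) hc'
  have h4 : (τ.tr (star (c ()) * star b)).re = (τ.tr (c () * b)).re := by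
    rw [← star_mul, τ.tr_star, τ.tr_mul_comm]; simp
  have h5 := Complex.re_le_norm (τ.tr (c () * b))
  change _ ≤ (τ.tr (star (c ()) * star b)).re + ε at h
  linarith

theorem colNorm_le_sum (a : ι → A) : τ.colNorm a ≤ ∑ i, τ.norm₁ (a i) := by
  refine le_of_forall_pos_le_add fun ε hε => ?_
  obtain ⟨c, hc, h⟩ := τ.exists_dual a ε hε
  have h1 : (τ.tr (∑ i, star (c i) * a i)).re ≤ ∑ i, τ.norm₁ (a i) := by
    rw [map_sum, Complex.re_sum]
    refine Finset.sum_le_sum fun i _ => (Complex.re_le_norm _).trans ?_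
    exact τ.norm_tr_mul_le_of_le_one _ _ (by simpa using norm_le_one_of_sum hc i)
  linarith

theorem abs_colNorm_sub_le (a b : ι → A) :
    |τ.colNorm a - τ.colNorm b| ≤ ∑ i, τ.norm₁ (a i - b i) := by
  have h1 := τ.colNorm_add_le (a - b) b
  have h2 := τ.colNorm_add_le (b - a) a
  rw [sub_add_cancel] at h1 h2
  have h3 := τ.colNorm_le_sum (a - b)
  have h4 : τ.colNorm (b - a) = τ.colNorm (a - b) := by rw [← τ.colNorm_neg, neg_sub]
  rw [abs_le]
  simp only [Pi.sub_apply] at h3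
  constructor <;> linarith


/-! ### The spaces `L¹` and `L²` -/

/-- The algebra `A`, to be equipped with the norm `‖a‖₁ = τ(|a|)`. -/
@[nolint unusedArguments]
noncomputable def PreL1 (_τ : NormalTrace A) : Type _ := A

noncomputable instance : AddCommGroup τ.PreL1 := inferInstanceAs (AddCommGroup A)
noncomputable instance : Module ℂ τ.PreL1 := inferInstanceAs (Module ℂ A)

/-- The identity map from `A` to `A` with the norm `‖·‖₁`. -/
noncomputable def toPreL1 : A ≃ₗ[ℂ] τ.PreL1 := LinearEquiv.refl ℂ _

noncomputable instance : Norm τ.PreL1 := ⟨fun a => τ.norm₁ (τ.toPreL1.symm a)⟩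

theorem norm_toPreL1 (a : A) : ‖τ.toPreL1 a‖ = τ.norm₁ a := rfl

theorem norm₁_eq_zero {a : A} (h : τ.norm₁ a = 0) : a = 0 := by
  have h0 := CFC.abs_nonneg a
  have hs : star (CFC.sqrt (CFC.abs a)) = CFC.sqrt (CFC.abs a) :=
    (IsSelfAdjoint.of_nonneg (CFC.sqrt_nonneg _)).star_eq
  have him : (τ.tr (CFC.abs a)).im = 0 := by
    have := (Complex.le_def.1 (τ.tr.map_nonneg h0)).2
    simpa using this.symm
  have h1 : CFC.sqrt (CFC.abs a) = 0 := τ.faithful _ (by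
    rw [hs, CFC.sqrt_mul_sqrt_self _ h0]; exact Complex.ext h him)
  rwa [CFC.sqrt_eq_zero_iff _ h0, CFC.abs_eq_zero_iff] at h1

theorem preL1Core : NormedSpace.Core ℂ τ.PreL1 where
  norm_nonneg a := τ.norm₁_nonneg a
  norm_smul z a := τ.norm₁_smul z a
  norm_triangle a b := τ.norm₁_add_le a b
  norm_eq_zero_iff a := ⟨fun h => τ.norm₁_eq_zero h, fun h => by
    subst h; change τ.norm₁ (0 : A) = 0; simp [norm₁]⟩

noncomputable instance : NormedAddCommGroup τ.PreL1 := NormedAddCommGroup.ofCore τ.preL1Core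
noncomputable instance : NormedSpace ℂ τ.PreL1 := NormedSpace.ofCore τ.preL1Core

/-- The non-commutative space `L¹(A, τ)`: the completion of `A` for `‖a‖₁ = τ(|a|)`. -/
abbrev L1 : Type _ := UniformSpace.Completion τ.PreL1

/-- The inclusion of `A` in `L¹(A, τ)`. -/
noncomputable def toL1 (a : A) : τ.L1 := (τ.toPreL1 a : UniformSpace.Completion τ.PreL1)

/-- The non-commutative space `L²(A, τ)`: the completion of `A` for `‖a‖₂ = τ(a⋆ a)^{1/2}`. -/
noncomputable abbrev L2 : Type _ := τ.tr.GNS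

/-- The inclusion of `A` in `L²(A, τ)`. -/
noncomputable def toL2 (a : A) : τ.L2 := (τ.tr.toPreGNS a : UniformSpace.Completion τ.tr.PreGNS)

theorem norm_toL1 (a : A) : ‖τ.toL1 a‖ = (τ.tr (CFC.abs a)).re :=
  UniformSpace.Completion.norm_coe _

theorem norm_toL2 (a : A) : ‖τ.toL2 a‖ = √(τ.tr (star a * a)).re :=
  UniformSpace.Completion.norm_coe _

/-- The adjoint `x ↦ x⋆` on `A`, for the norm `‖·‖₁`. -/
noncomputable def preStar : NormedAddGroupHom τ.PreL1 τ.PreL1 where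
  toFun a := τ.toPreL1 (star (τ.toPreL1.symm a))
  map_add' a b := by simp
  bound' := ⟨1, fun a => by rw [one_mul]; exact (τ.norm₁_star a).le⟩

/-- The adjoint `x ↦ x⋆` on `L¹`. -/
noncomputable def starL1 : NormedAddGroupHom τ.L1 τ.L1 := τ.preStar.completion

theorem starL1_toL1 (a : A) : τ.starL1 (τ.toL1 a) = τ.toL1 (star a) :=
  NormedAddGroupHom.completion_coe _ _

/-- The functional `a ↦ τ(a m)` on `A`, for the norm `‖·‖₁`. -/
noncomputable def preTrMul (m : A) : τ.PreL1 →L[ℂ] ℂ :=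
  LinearMap.mkContinuous
    { toFun := fun a => τ.tr (τ.toPreL1.symm a * m)
      map_add' := fun a b => by simp [add_mul]
      map_smul' := fun z a => by simp } ‖m‖ fun a => by
    change ‖τ.tr (τ.toPreL1.symm a * m)‖ ≤ _
    rw [τ.tr_mul_comm]
    exact τ.norm_tr_mul_le _ m

/-- The functional `x ↦ τ(x m)` on `L¹`, for `m ∈ A`. -/
noncomputable def trMul (m : A) : τ.L1 →L[ℂ] ℂ :=
  (τ.preTrMul m).extend UniformSpace.Completion.toComplL

theorem trMul_toL1 (m a : A) : τ.trMul m (τ.toL1 a) = τ.tr (a * m) :=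
  ContinuousLinearMap.extend_eq _ UniformSpace.Completion.denseRange_coe
    (UniformSpace.Completion.isUniformInducing_coe _) (τ.toPreL1 a)

theorem norm₁_mul_le (a b : A) : τ.norm₁ (a * b) ≤ ‖τ.tr.toPreGNS a‖ * ‖τ.tr.toPreGNS b‖ := by
  refine le_of_forall_pos_le_add fun ε hε => ?_
  obtain ⟨c, hc, h⟩ := τ.exists_dual (fun _ : Unit => a * b) ε hε
  have hc' : ‖c ()‖ ≤ 1 := norm_le_one_of_sum hc ()
  rw [← norm₁_eq, Fintype.sum_unique] at h
  change _ ≤ (τ.tr (star (c ()) * (a * b))).re + ε at h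
  set d := star a * c () with hd
  have h1 : τ.tr (star (c ()) * (a * b)) = ⟪τ.tr.toPreGNS d, τ.tr.toPreGNS b⟫_ℂ := by
    rw [PositiveLinearMap.preGNS_inner_def]; simp [hd, mul_assoc]
  have h2 : ‖τ.tr.toPreGNS d‖ ≤ ‖τ.tr.toPreGNS a‖ := by
    rw [PositiveLinearMap.preGNS_norm_def, PositiveLinearMap.preGNS_norm_def]
    refine Real.sqrt_le_sqrt ?_
    simp only [PositiveLinearMap.ofPreGNS_toPreGNS, hd, star_mul, star_star]
    rw [τ.tr_mul_comm]
    have h3 : star (star (c ())) * star (c ()) ≤ 1 :=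
      star_mul_self_le_one (by rwa [norm_star])
    have h4 := τ.re_mono (star_left_conjugate_le_conjugate h3 a)
    simpa [mul_assoc] using h4
  have h5 : (τ.tr (star (c ()) * (a * b))).re ≤ ‖τ.tr.toPreGNS a‖ * ‖τ.tr.toPreGNS b‖ := by
    refine (Complex.re_le_norm _).trans ?_
    rw [h1]
    refine (norm_inner_le_norm _ _).trans ?_
    gcongr
  linarith

/-- The product `(a, b) ↦ a b` of `A`, from `‖·‖₂ × ‖·‖₂` to `‖·‖₁`. -/
noncomputable def preMul : τ.tr.PreGNS →L[ℂ] τ.tr.PreGNS →L[ℂ] τ.L1 :=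
  LinearMap.mkContinuous₂
    (LinearMap.mk₂ ℂ (fun a b => τ.toL1 (τ.tr.ofPreGNS a * τ.tr.ofPreGNS b))
      (fun a b c => by simp [toL1, add_mul, UniformSpace.Completion.coe_add])
      (fun z a b => by simp [toL1, UniformSpace.Completion.coe_smul])
      (fun a b c => by simp [toL1, mul_add, UniformSpace.Completion.coe_add])
      (fun z a b => by simp [toL1, UniformSpace.Completion.coe_smul])) 1
    fun a b => by
      rw [one_mul]
      exact (UniformSpace.Completion.norm_coe _).le.trans (τ.norm₁_mul_le _ _)

/-- The product `L² × L² → L¹`, the continuous bilinear extension of the product of `A`. -/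
noncomputable def mulL1 : τ.L2 →L[ℂ] τ.L2 →L[ℂ] τ.L1 :=
  ((τ.preMul.extend UniformSpace.Completion.toComplL).flip.extend
    UniformSpace.Completion.toComplL).flip

theorem mulL1_toL2 (a b : A) : τ.mulL1 (τ.toL2 a) (τ.toL2 b) = τ.toL1 (a * b) := by
  have h1 := ContinuousLinearMap.extend_eq
    (τ.preMul.extend UniformSpace.Completion.toComplL).flip
    (e := UniformSpace.Completion.toComplL) UniformSpace.Completion.denseRange_coe
    (UniformSpace.Completion.isUniformInducing_coe _) (τ.tr.toPreGNS b)
  have h2 := ContinuousLinearMap.extend_eq τ.preMul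
    (e := UniformSpace.Completion.toComplL) UniformSpace.Completion.denseRange_coe
    (UniformSpace.Completion.isUniformInducing_coe _) (τ.tr.toPreGNS a)
  have h3 := congrArg (fun f => f (τ.toL2 a)) h1
  have h4 := congrArg (fun f => f (τ.tr.toPreGNS b)) h2
  exact h3.trans h4

/-- The product `y b ∈ L²` of `y ∈ A` and `b ∈ L²`. -/
noncomputable def smulL2 (y : A) (b : τ.L2) : τ.L2 := τ.tr.gnsStarAlgHom y b

theorem smulL2_toL2 (y b : A) : τ.smulL2 y (τ.toL2 b) = τ.toL2 (y * b) := by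
  simp [smulL2, toL2]

/-! ### Square functions -/

/-- The norm `‖(∑ |dᵢ|²)^{1/2}‖₁` of a finite family in `L¹`: the continuous extension of the same
expression for families in `A`. -/
noncomputable def colNormL1 (d : ι → τ.L1) : ℝ :=
  IsDenseInducing.extend
    (i := fun (a : ι → τ.PreL1) i => (a i : UniformSpace.Completion τ.PreL1))
    ⟨Topology.IsInducing.piMap fun _ => (UniformSpace.Completion.isUniformInducing_coe _).isInducing,
      DenseRange.piMap fun _ => UniformSpace.Completion.denseRange_coe⟩
    (fun a => τ.colNorm fun i => τ.toPreL1.symm (a i)) d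

theorem uniformContinuous_colNorm :
    UniformContinuous fun a : ι → τ.PreL1 => τ.colNorm fun i => τ.toPreL1.symm (a i) := by
  rw [Metric.uniformContinuous_iff]
  intro ε hε
  refine ⟨ε / (Fintype.card ι + 1), by positivity, fun {a b} h => ?_⟩
  rw [Real.dist_eq]
  refine (τ.abs_colNorm_sub_le _ _).trans_lt ?_
  have h1 : ∀ i ∈ Finset.univ, τ.norm₁ (τ.toPreL1.symm (a i) - τ.toPreL1.symm (b i)) ≤
      ε / (Fintype.card ι + 1) := fun i _ => by
    have h2 := (dist_le_pi_dist a b i).trans h.le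
    rwa [dist_eq_norm] at h2
  refine (Finset.sum_le_card_nsmul _ _ _ h1).trans_lt ?_
  rw [Finset.card_univ, nsmul_eq_mul, mul_div_assoc', div_lt_iff₀ (by positivity)]
  nlinarith

theorem uniformContinuous_colNormL1 : UniformContinuous (τ.colNormL1 (ι := ι)) :=
  uniformContinuous_uniformly_extend
    (Isometry.piMap _ fun _ => UniformSpace.Completion.coe_isometry).isUniformInducing
    (DenseRange.piMap fun _ => UniformSpace.Completion.denseRange_coe) τ.uniformContinuous_colNorm

theorem colNormL1_toL1 (a : ι → A) :
    τ.colNormL1 (fun i => τ.toL1 (a i)) = (τ.tr (CFC.sqrt (∑ i, star (a i) * a i))).re :=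
  IsDenseInducing.extend_eq _ τ.uniformContinuous_colNorm.continuous fun i => τ.toPreL1 (a i)

/-- The norm `‖(∑ₙ |dₙ|²)^{1/2}‖₁ ∈ [0, ∞]` of a sequence in `L¹`: the supremum (which is the limit)
of the norms for the partial sums. -/
noncomputable def squareNorm (d : ℕ → τ.L1) : ℝ≥0∞ :=
  ⨆ N : ℕ, ENNReal.ofReal (τ.colNormL1 fun i : Fin N => d i)

end NormalTrace
end Trace

/-! ### Martingales and Hardy spaces -/

section Martingale

variable {H : Type*} [NormedAddCommGroup H] [InnerProductSpace ℂ H] [CompleteSpace H]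

/-- An increasing filtration of von Neumann subalgebras of `M` which together generate `M`; as their
union is a unital `⋆`-algebra, this means that it is w*-dense in `M`. -/
structure Filtration (M : VonNeumannAlgebra H) where
  /-- the subalgebras -/
  alg : ℕ → VonNeumannAlgebra H
  mono : ∀ n, alg n ≤ alg (n + 1)
  le : ∀ n, alg n ≤ M
  generates : Set.centralizer (Set.centralizer (⋃ n, (alg n : Set (H →L[ℂ] H)))) = M

variable {M : VonNeumannAlgebra H} (τ : NormalTrace M) (F : Filtration M)

/-- The subspace `L¹(N)` of `L¹(M)`, for a von Neumann subalgebra `N` of `M`. -/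
def L1Sub (N : VonNeumannAlgebra H) : Set τ.L1 :=
  closure (τ.toL1 '' {a : M | (a : H →L[ℂ] H) ∈ N})

/-- `y` is the conditional expectation of `x ∈ L¹(M)` on the von Neumann subalgebra `N`: the element
of `L¹(N)` with `τ(y m) = τ(x m)` for all `m ∈ N`. -/
def IsCondExp (N : VonNeumannAlgebra H) (x y : τ.L1) : Prop :=
  y ∈ L1Sub τ N ∧ ∀ m : M, (m : H →L[ℂ] H) ∈ N → τ.trMul m y = τ.trMul m x

/-- Non-commutative martingales. The sequence is indexed from `0`, so that `x 0` is the first term. -/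
def IsMartingale (x : ℕ → τ.L1) : Prop := ∀ n, IsCondExp τ (F.alg n) (x (n + 1)) (x n)

/-- The difference sequence of a martingale, with the convention that the term before `x 0`
vanishes. -/
noncomputable def diffSeq (x : ℕ → τ.L1) : ℕ → τ.L1
  | 0 => x 0
  | n + 1 => x (n + 1) - x n

/-- The `H¹`-norm, with values in `[0, ∞]`: the infimum over all decompositions `x = y + z` as sums of
two martingales of `‖(∑ |dyₙ|²)^{1/2}‖₁ + ‖(∑ |dzₙ⋆|²)^{1/2}‖₁`. -/
noncomputable def normH1 (x : ℕ → τ.L1) : ℝ≥0∞ :=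
  ⨅ (y : ℕ → τ.L1) (z : ℕ → τ.L1) (_ : IsMartingale τ F y) (_ : IsMartingale τ F z)
    (_ : x = y + z),
    τ.squareNorm (diffSeq τ y) + τ.squareNorm fun n => τ.starL1 (diffSeq τ z n)

/-- The `H¹_max`-norm, with values in `[0, ∞]`: the infimum of `‖a‖₂ (sup ‖yₙ‖) ‖b‖₂` over all
factorizations `xₙ = a yₙ b` with `a, b ∈ L²(M)` and `(yₙ)` a bounded sequence in `M`. -/
noncomputable def normH1max (x : ℕ → τ.L1) : ℝ≥0∞ :=
  ⨅ (a : τ.L2) (b : τ.L2) (y : ℕ → M) (_ : BddAbove (Set.range fun n => ‖y n‖))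
    (_ : ∀ n, x n = τ.mulL1 a (τ.smulL2 (y n) b)),
    ‖a‖ₑ * (⨆ n, ‖y n‖ₑ) * ‖b‖ₑ

/-- The Hardy space `H¹`, defined by the square functions. -/
def H1 : Set (ℕ → τ.L1) := {x | IsMartingale τ F x ∧ normH1 τ F x < ⊤}

/-- The Hardy space `H¹_max`, defined by the maximal function. -/
def H1max : Set (ℕ → τ.L1) := {x | IsMartingale τ F x ∧ normH1max τ x < ⊤}

end Martingale

end NCMartingale

/-!
The counterexample lives in a direct sum of matrix algebras, realized as the algebra of the operators
on `ℓ²(ℕ)` that are block diagonal for a partition of `ℕ` into finite blocks, with the trace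
`T ↦ ∑ wᵢ Tᵢᵢ` for weights that are constant on the blocks. The `n`-th algebra of the filtration consists
of the operators that are diagonal outside the first `n` basis vectors.

Let `f(i)` be the least index of the block of `i`. The martingale `xₙ = ∑_{i < n} cᵢ e_{f(i), i}` has one
row in each block. The squares `|dxₙ⋆|²` are multiples of the diagonal matrix units `e_{f(n), f(n)}`, so
that the `H¹`-norm of `x` is at most the weighted sum of the `ℓ²`-norms of the rows
(`rowSum_mem_H1`).

On the other hand, if `xₙ = a yₙ b` and `∑ mⱼ mⱼ⋆ ≤ 1`, then the Cauchy–Schwarz inequality bounds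
`∑_{j < N} |τ(x_{tⱼ} mⱼ)|` by `sup ‖yₙ‖ √N ‖a‖₂ ‖b‖₂` (`NormalTrace.sum_norm_trMul_le`). In a block with
first row `η`, let `V` be an orthogonal matrix and let `mⱼ` carry the `j`-th column of `V` into the first
column of the block. As `x_{tⱼ}` only contains the entries of `η` before the `j`-th one, the sum becomes
the pairing `⟨η, T(V) 1⟩` with the strictly upper triangular part `T(V)` of `V`
(`exists_bound_of_mem_H1max`). With `η` a multiple of `V 1`, this is large compared with
`√N ‖η‖₂`, because triangular truncation is unbounded: tensor products of small rotations give
orthogonal `V` of size `N` for which `⟨V 1, T(V) 1⟩ / N` is as large as desired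
(`exists_triangularPairing_ge`). A sequence of such blocks, with rows whose `H¹`-norms are summable but
decrease slowly compared with the growth of these ratios, gives a martingale in `H¹` which is not in
`H¹_max`.
-/

namespace NCMartingale

/-! ### Triangular truncation of orthogonal matrices -/

section TriangularTruncation

open Matrix

/-- The pairing `⟨V 1, T(V) 1⟩` of the row sums of a square matrix `V` with those of its strictly upper
triangular part `T(V)`. -/
def triangularPairing {n : ℕ} (V : Matrix (Fin n) (Fin n) ℝ) : ℝ :=
  ∑ j, ∑ i, if i < j then (∑ l, V i l) * V i j else 0

theorem sum_sq_rowSum {n : ℕ} {V : Matrix (Fin n) (Fin n) ℝ} (hV : V * Vᵀ = 1) :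
    ∑ i, (∑ l, V i l) ^ 2 = n := by
  have hV' : Vᵀ * V = 1 := mul_eq_one_comm.1 hV
  have h : (V *ᵥ 1) ⬝ᵥ (V *ᵥ 1) = (1 : Fin n → ℝ) ⬝ᵥ 1 := by
    rw [dotProduct_mulVec, ← mulVec_transpose, mulVec_mulVec, hV', one_mulVec]
  simpa [dotProduct, mulVec, sq] using h

/-- The matrix `V ⊗ R`, for the rotation `R` with entries `c` and `±s`, where the new factor is the
leading one in the order of the index set. -/
def rotationStep {n : ℕ} (c s : ℝ) (V : Matrix (Fin n) (Fin n) ℝ) :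
    Matrix (Fin (n + n)) (Fin (n + n)) ℝ :=
  (fromBlocks (c • V) (s • V) (-(s • V)) (c • V)).reindex finSumFinEquiv finSumFinEquiv

theorem rotationStep_mul_transpose {n : ℕ} {c s : ℝ} (hcs : c ^ 2 + s ^ 2 = 1)
    {V : Matrix (Fin n) (Fin n) ℝ} (hV : V * Vᵀ = 1) :
    rotationStep c s V * (rotationStep c s V)ᵀ = 1 := by
  have h1 : c * c + s * s = 1 := by linarith
  simp only [rotationStep, reindex_apply, transpose_submatrix, submatrix_mul_equiv]
  rw [fromBlocks_transpose, fromBlocks_multiply]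
  simp only [transpose_smul, transpose_neg, smul_mul_smul_comm, hV, neg_mul, mul_neg, neg_neg]
  rw [← add_smul, h1, mul_comm s c, neg_add_cancel, ← add_smul, add_comm (s * s), h1, one_smul,
    fromBlocks_one, submatrix_one_equiv]

theorem triangularPairing_rotationStep {n : ℕ} {c s : ℝ} {V : Matrix (Fin n) (Fin n) ℝ}
    (hV : V * Vᵀ = 1) :
    triangularPairing (rotationStep c s V) =
      2 * c ^ 2 * triangularPairing V + s * (c + s) * n := by
  have h1 : ∀ i j : Fin n, Fin.castAdd n i < Fin.natAdd n j := fun i j => by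
    rw [Fin.lt_def]; simp; omega
  have h2 : ∀ i j : Fin n, ¬ Fin.natAdd n i < Fin.castAdd n j := fun i j => (h1 j i).le.not_gt
  have h3 : ∀ i j : Fin n, Fin.castAdd n i < Fin.castAdd n j ↔ i < j := fun i j => by
    simp only [Fin.lt_def, Fin.val_castAdd]
  have h4 : ∀ i j : Fin n, Fin.natAdd n i < Fin.natAdd n j ↔ i < j := fun i j => by
    simp only [Fin.lt_def, Fin.val_natAdd, Nat.add_lt_add_iff_left]
  have e : (n : ℝ) = ∑ j, ∑ i, (∑ l, V i l) * V i j := by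
    rw [Finset.sum_comm, ← sum_sq_rowSum hV]
    exact Finset.sum_congr rfl fun i _ => by rw [← Finset.mul_sum, sq]
  rw [e]
  simp only [triangularPairing, rotationStep, Fin.sum_univ_add, h1, h2, h3, h4, reindex_apply,
    submatrix_apply, finSumFinEquiv_symm_apply_castAdd, finSumFinEquiv_symm_apply_natAdd,
    fromBlocks_apply₁₁, fromBlocks_apply₁₂, fromBlocks_apply₂₁, fromBlocks_apply₂₂, Matrix.smul_apply,
    Matrix.neg_apply, smul_eq_mul, if_true, if_false, add_zero, Finset.mul_sum,
    ← Finset.sum_add_distrib]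
  refine Finset.sum_congr rfl fun j _ => Finset.sum_congr rfl fun i _ => ?_
  simp only [Finset.sum_add_distrib, Finset.sum_neg_distrib, ← Finset.mul_sum]
  split_ifs <;> ring

/-- Triangular truncation is unbounded on orthogonal matrices: the pairing of `V 1` with `T(V) 1`, where
both `1` and `V 1` have norm `√n`, is not bounded by a multiple of `n`. -/
theorem exists_triangularPairing_ge (K : ℝ) :
    ∃ (n : ℕ) (V : Matrix (Fin n) (Fin n) ℝ), 0 < n ∧ V * Vᵀ = 1 ∧
      K * n ≤ triangularPairing V := by
  -- The set of attained ratios is stable under `g ↦ c² g + s (c + s) / 2` for `c² + s² = 1`. Small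
  -- values of `s` show that its supremum cannot be finite.
  set G : Set ℝ := {g | ∃ (n : ℕ) (V : Matrix (Fin n) (Fin n) ℝ), 0 < n ∧ V * Vᵀ = 1 ∧
    g * n = triangularPairing V} with hG
  have h0 : (0 : ℝ) ∈ G := ⟨1, 1, one_pos, by simp, by simp [triangularPairing]⟩
  have hstep : ∀ g ∈ G, ∀ c s : ℝ, c ^ 2 + s ^ 2 = 1 → c ^ 2 * g + s * (c + s) / 2 ∈ G := by
    rintro g ⟨n, V, hn, hV, hg⟩ c s hcs
    refine ⟨n + n, rotationStep c s V, by omega, rotationStep_mul_transpose hcs hV, ?_⟩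
    rw [triangularPairing_rotationStep hV, ← hg]
    push_cast
    ring
  by_contra! hK
  have hbdd : BddAbove G := ⟨K, by
    rintro g ⟨n, V, hn, hV, hg⟩
    have h := hK n V hn hV
    rw [← hg] at h
    exact (lt_of_mul_lt_mul_right h n.cast_nonneg).le⟩
  set S := sSup G with hS
  have hS0 : 0 ≤ S := le_csSup hbdd h0
  have hle : ∀ c s : ℝ, c ^ 2 + s ^ 2 = 1 → c ^ 2 * S + s * (c + s) / 2 ≤ S := by
    intro c s hcs
    by_cases hc : c ^ 2 = 0
    · have := le_csSup hbdd (hstep 0 h0 c s hcs)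
      rw [hc]; rw [hc] at this; linarith
    have hc' : 0 < c ^ 2 := lt_of_le_of_ne (sq_nonneg c) (Ne.symm hc)
    have : S ≤ (S - s * (c + s) / 2) / c ^ 2 := by
      refine csSup_le ⟨0, h0⟩ fun g hg => ?_
      rw [le_div_iff₀ hc']
      have := le_csSup hbdd (hstep g hg c s hcs)
      linarith
    rw [le_div_iff₀ hc'] at this
    linarith
  -- the angle with `cot = 2 S`
  set r := √(1 + (2 * S) ^ 2) with hr
  have hr2 : r ^ 2 = 1 + (2 * S) ^ 2 := Real.sq_sqrt (by positivity)
  have hrpos : 0 < r := Real.sqrt_pos.2 (by positivity)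
  have h := hle (2 * S / r) (1 / r) (by field_simp; linarith)
  have h' : (2 * S / r) ^ 2 * S + 1 / r * (2 * S / r + 1 / r) / 2 = S + 1 / (2 * r ^ 2) := by
    field_simp
    rw [hr2]
    ring
  rw [h'] at h
  have : 0 < 1 / (2 * r ^ 2) := by positivity
  linarith

end TriangularTruncation

/-! ### A bounded functional for the maximal norm -/

section Duality

namespace NormalTrace

variable {A : Type*} [CStarAlgebra A] [PartialOrder A] [StarOrderedRing A] (τ : NormalTrace A)

theorem norm_toL2_mul_le (y b : A) : ‖τ.toL2 (y * b)‖ ≤ ‖y‖ * ‖τ.toL2 b‖ := by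
  rw [← τ.smulL2_toL2]
  refine (ContinuousLinearMap.le_opNorm _ _).trans ?_
  gcongr
  exact NonUnitalStarAlgHom.norm_apply_le τ.tr.gnsStarAlgHom y

theorem norm_tr_mul_le_toL2 (a b : A) : ‖τ.tr (a * b)‖ ≤ ‖τ.toL2 a‖ * ‖τ.toL2 b‖ := by
  have h := τ.norm_tr_mul_le_of_le_one (a * b) 1 (by
    cases subsingleton_or_nontrivial A
    · simp [Subsingleton.elim (1 : A) 0]
    · simp)
  rw [one_mul] at h
  refine (h.trans (τ.norm₁_mul_le a b)).trans_eq ?_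
  simp [toL2]

theorem sum_norm_toL2_mul_sq_le {ι : Type*} [Fintype ι] (b : A) (m : ι → A)
    (hm : ∑ i, m i * star (m i) ≤ 1) : ∑ i, ‖τ.toL2 (b * m i)‖ ^ 2 ≤ ‖τ.toL2 b‖ ^ 2 := by
  have hn : ∀ c : A, ‖τ.toL2 c‖ ^ 2 = (τ.tr (star c * c)).re := fun c => by
    rw [norm_toL2, Real.sq_sqrt (τ.re_nonneg (star_mul_self_nonneg c))]
  have h := τ.re_mono (star_right_conjugate_le_conjugate hm b)
  simp only [hn]
  rw [mul_one, τ.tr_mul_comm b] at h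
  refine le_trans (le_of_eq ?_) h
  rw [Finset.mul_sum, Finset.sum_mul, map_sum, Complex.re_sum]
  refine Finset.sum_congr rfl fun i _ => ?_
  rw [τ.tr_mul_comm, star_mul]
  simp only [mul_assoc]

/-- The functional `(xᵢ) ↦ ∑ τ(xᵢ mᵢ)` is bounded for the `L¹(ℓ^∞)`-norm when `∑ mᵢ mᵢ⋆ ≤ 1`. -/
theorem sum_norm_trMul_le {ι : Type*} [Fintype ι] (a b : τ.L2) (y m : ι → A) (C : ℝ)
    (hy : ∀ i, ‖y i‖ ≤ C) (hm : ∑ i, m i * star (m i) ≤ 1) :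
    ∑ i, ‖τ.trMul (m i) (τ.mulL1 a (τ.smulL2 (y i) b))‖ ≤
      C * √(Fintype.card ι) * (‖a‖ * ‖b‖) := by
  have hs : ∀ i, Continuous fun b : τ.L2 => τ.smulL2 (y i) b := fun i =>
    (τ.tr.gnsStarAlgHom (y i)).continuous
  induction a, b using UniformSpace.Completion.induction_on₂ with
  | hp =>
    refine isClosed_le ?_ (by fun_prop)
    refine continuous_finsetSum _ fun i _ => ((τ.trMul (m i)).continuous.comp ?_).norm
    exact (τ.mulL1.continuous.comp continuous_fst).clm_apply ((hs i).comp continuous_snd)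
  | ih a b =>
    change ∑ i, ‖τ.trMul (m i) (τ.mulL1 (τ.toL2 a) (τ.smulL2 (y i) (τ.toL2 b)))‖ ≤
      C * √(Fintype.card ι) * (‖τ.toL2 a‖ * ‖τ.toL2 b‖)
    by_cases hι : IsEmpty ι
    · simp
    rw [not_isEmpty_iff] at hι
    have hC : 0 ≤ C := (norm_nonneg _).trans (hy (Classical.arbitrary ι))
    have h1 : ∀ i ∈ Finset.univ, ‖τ.trMul (m i) (τ.mulL1 (τ.toL2 a) (τ.smulL2 (y i) (τ.toL2 b)))‖ ≤
        C * ‖τ.toL2 a‖ * ‖τ.toL2 (τ.tr.ofPreGNS b * m i)‖ := fun i _ => by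
      change ‖τ.trMul (m i) (τ.mulL1 (τ.toL2 (τ.tr.ofPreGNS a))
        (τ.smulL2 (y i) (τ.toL2 (τ.tr.ofPreGNS b))))‖ ≤ _
      rw [smulL2_toL2, mulL1_toL2, trMul_toL1, mul_assoc, mul_assoc]
      refine (τ.norm_tr_mul_le_toL2 _ _).trans ?_
      rw [mul_comm C, mul_assoc]
      refine mul_le_mul_of_nonneg_left ?_ (norm_nonneg _)
      refine (τ.norm_toL2_mul_le _ _).trans ?_
      gcongr
      exact hy i
    refine (Finset.sum_le_sum h1).trans ?_
    rw [← Finset.mul_sum]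
    have h2 : ∑ i, ‖τ.toL2 (τ.tr.ofPreGNS b * m i)‖ ≤ √(Fintype.card ι) * ‖τ.toL2 b‖ := by
      refine abs_le_of_sq_le_sq' ?_ (by positivity) |>.2
      refine (sq_sum_le_card_mul_sum_sq).trans ?_
      rw [mul_pow, Real.sq_sqrt (by positivity), Finset.card_univ]
      gcongr
      exact τ.sum_norm_toL2_mul_sq_le _ m hm
    calc C * ‖τ.toL2 a‖ * ∑ i, ‖τ.toL2 (τ.tr.ofPreGNS b * m i)‖
        ≤ C * ‖τ.toL2 a‖ * (√(Fintype.card ι) * ‖τ.toL2 b‖) := by gcongr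
      _ = _ := by ring

end NormalTrace

end Duality

/-! ### Normality of vector states -/

section VectorStates

open Filter Topology

variable {H : Type*} [NormedAddCommGroup H] [InnerProductSpace ℂ H]

theorem re_inner_mono {a b : H →L[ℂ] H} (h : a ≤ b) (x : H) :
    (⟪x, a x⟫_ℂ).re ≤ (⟪x, b x⟫_ℂ).re := by
  have := ((ContinuousLinearMap.le_def a b).1 h).re_inner_nonneg_right x
  simpa [inner_sub_right] using this

variable [CompleteSpace H]

/-- Vector states are normal: the supremum of a bounded directed set in a von Neumann algebra is its
weak limit. Here the weak limit is taken along an ultrafilter; it lies in the algebra because it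
commutes with the commutant. -/
theorem le_of_isLUB_of_re_inner_le {M : VonNeumannAlgebra H} {S : Set M} {s : M}
    (hne : S.Nonempty) (hdir : DirectedOn (· ≤ ·) S) (hpos : ∀ a ∈ S, 0 ≤ a) (hs : IsLUB S s)
    (ξ : H) {u : ℝ} (hu : ∀ a ∈ S, (⟪ξ, (a : H →L[ℂ] H) ξ⟫_ℂ).re ≤ u) :
    (⟪ξ, (s : H →L[ℂ] H) ξ⟫_ℂ).re ≤ u := by
  have : Nonempty S := hne.to_subtype
  have : IsDirectedOrder S := ⟨fun a b => by
    obtain ⟨c, hc, h1, h2⟩ := hdir a a.2 b b.2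
    exact ⟨⟨c, hc⟩, h1, h2⟩⟩
  let op : S → H →L[ℂ] H := fun a => ((a : M) : H →L[ℂ] H)
  have hnorm : ∀ a : S, ‖op a‖ ≤ ‖s‖ := fun a =>
    CStarAlgebra.norm_le_norm_of_nonneg_of_le (hpos a a.2) (hs.1 a.2)
  have hbound : ∀ (a : S) (x y : H), ‖⟪op a x, y⟫_ℂ‖ ≤ ‖s‖ * ‖x‖ * ‖y‖ := fun a x y =>
    (norm_inner_le_norm _ _).trans (by
      gcongr; exact (op a).le_of_opNorm_le (hnorm a) x)
  let U : Ultrafilter S := Ultrafilter.of atTop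
  have hU : (U : Filter S) ≤ atTop := Ultrafilter.of_le atTop
  have hlim : ∀ x y : H, ∃ l : ℂ, Tendsto (fun a : S => ⟪op a x, y⟫_ℂ) U (𝓝 l) := fun x y => by
    obtain ⟨l, -, hl⟩ := (isCompact_closedBall (0 : ℂ) (‖s‖ * ‖x‖ * ‖y‖)).ultrafilter_le_nhds
      (U.map fun a : S => ⟪op a x, y⟫_ℂ) (by
        rw [Ultrafilter.coe_map, le_principal_iff, mem_map]
        exact univ_mem' fun a => by simpa using hbound a x y)
    exact ⟨l, hl⟩
  choose L hL using hlim
  let B : H →L⋆[ℂ] H →L[ℂ] ℂ := LinearMap.mkContinuous₂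
    (LinearMap.mk₂'ₛₗ (starRingEnd ℂ) (RingHom.id ℂ) L
      (fun x x' y => tendsto_nhds_unique (hL _ _) (by
        simpa [inner_add_left] using (hL x y).add (hL x' y)))
      (fun c x y => tendsto_nhds_unique (hL _ _) (by
        simpa [inner_smul_left, mul_comm] using (hL x y).const_mul (starRingEnd ℂ c)))
      (fun x y y' => tendsto_nhds_unique (hL _ _) (by
        simpa [inner_add_right] using (hL x y).add (hL x y')))
      (fun c x y => tendsto_nhds_unique (hL _ _) (by
        simpa [inner_smul_right] using (hL x y).const_mul c)))
    ‖s‖ fun x y => le_of_tendsto (hL x y).norm (Eventually.of_forall fun a => hbound a x y)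
  let T : H →L[ℂ] H := InnerProductSpace.continuousLinearMapOfBilin B
  have hT : ∀ x y, ⟪T x, y⟫_ℂ = L x y := fun x y =>
    InnerProductSpace.continuousLinearMapOfBilin_apply B x y
  have hTM : T ∈ M := by
    rw [← M.commutant_commutant, VonNeumannAlgebra.mem_commutant_iff]
    intro g hg
    refine ContinuousLinearMap.ext fun x => ext_inner_right ℂ fun y => ?_
    change ⟪g (T x), y⟫_ℂ = ⟪T (g x), y⟫_ℂ
    rw [← ContinuousLinearMap.adjoint_inner_right, hT, hT]
    refine tendsto_nhds_unique (hL x _) ((hL (g x) y).congr fun a => ?_)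
    have h := congrArg (fun f : H →L[ℂ] H => f x)
      (VonNeumannAlgebra.mem_commutant_iff.1 hg (op a) (a : M).2)
    change op a (g x) = g (op a x) at h
    rw [h, ContinuousLinearMap.adjoint_inner_right]
  have hTup : (⟨T, hTM⟩ : M) ∈ upperBounds S := fun a ha => by
    change (a : H →L[ℂ] H) ≤ T
    rw [ContinuousLinearMap.le_def, ContinuousLinearMap.isPositive_iff_complex]
    intro x
    have h0 : 0 ≤ ⟪(T - (a : H →L[ℂ] H)) x, x⟫_ℂ := by
      rw [sub_apply, inner_sub_left, hT]
      refine ge_of_tendsto ((hL x x).sub_const _) ?_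
      filter_upwards [hU (mem_atTop (⟨a, ha⟩ : S))] with c hc
      have hc' : (a : H →L[ℂ] H) ≤ op c := hc
      rw [← inner_sub_left, ← sub_apply]
      exact ((ContinuousLinearMap.le_def _ _).1 hc').inner_nonneg_left x
    rw [Complex.le_def] at h0
    exact ⟨Complex.ext rfl h0.2, h0.1⟩
  have hsT : (s : H →L[ℂ] H) ≤ T := hs.2 hTup
  refine (re_inner_mono hsT ξ).trans ?_
  have h1 := (Complex.continuous_re.tendsto _).comp (hL ξ ξ)
  rw [← hT] at h1
  have h2 : (⟪ξ, T ξ⟫_ℂ).re = (⟪T ξ, ξ⟫_ℂ).re := inner_re_symm (𝕜 := ℂ) _ _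
  rw [h2]
  refine le_of_tendsto h1 (Eventually.of_forall fun a => ?_)
  have h3 : (⟪ξ, op a ξ⟫_ℂ).re = (⟪op a ξ, ξ⟫_ℂ).re := inner_re_symm (𝕜 := ℂ) _ _
  exact h3.symm.trans_le (hu a a.2)

end VectorStates

/-! ### Block diagonal operators and their filtration -/

section BlockAlgebra

variable {H : Type*} [NormedAddCommGroup H] [InnerProductSpace ℂ H]
  (b : HilbertBasis ℕ ℂ H)

theorem inner_basis (i j : ℕ) : ⟪b i, b j⟫_ℂ = if i = j then 1 else 0 :=
  orthonormal_iff_ite.1 b.orthonormal i j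

theorem ext_inner_basis {x y : H} (h : ∀ i, ⟪b i, x⟫_ℂ = ⟪b i, y⟫_ℂ) : x = y :=
  b.repr.injective (lp.ext (funext fun i => by simpa [b.repr_apply_apply] using h i))

theorem ext_basis {S T : H →L[ℂ] H} (h : ∀ j, S (b j) = T (b j)) : S = T :=
  ContinuousLinearMap.ext_on (by
    have := b.dense_span
    exact Submodule.dense_iff_topologicalClosure_eq_top.2 this) (by
    rintro _ ⟨j, rfl⟩; exact h j)

/-- The projection onto the span of the basis vectors with index in the fibre `f⁻¹(k)`. -/
noncomputable def fibreProj (f : ℕ → ℕ) (hf : ∀ k, (f ⁻¹' {k}).Finite) (k : ℕ) : H →L[ℂ] H :=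
  ∑ i ∈ (hf k).toFinset, InnerProductSpace.rankOne ℂ (b i) (b i)

variable {f : ℕ → ℕ} (hf : ∀ k, (f ⁻¹' {k}).Finite)

theorem inner_basis_fibreProj (i k : ℕ) (x : H) :
    ⟪b i, fibreProj b f hf k x⟫_ℂ = if f i = k then ⟪b i, x⟫_ℂ else 0 := by
  simp [fibreProj, inner_basis]

theorem fibreProj_basis (j k : ℕ) :
    fibreProj b f hf k (b j) = if f j = k then b j else 0 := by
  refine ext_inner_basis b fun i => ?_
  rw [inner_basis_fibreProj, apply_ite (fun x => ⟪b i, x⟫_ℂ), inner_zero_right, inner_basis]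
  split_ifs <;> simp_all

variable [CompleteSpace H]

theorem star_fibreProj (k : ℕ) : star (fibreProj b f hf k) = fibreProj b f hf k := by
  simp [fibreProj, ContinuousLinearMap.star_eq_adjoint]

/-- The von Neumann algebra of the operators which are block diagonal for the partition of the basis
into the (finite) fibres of `f`. -/
noncomputable def blockAlgebra (f : ℕ → ℕ) (hf : ∀ k, (f ⁻¹' {k}).Finite) :
    VonNeumannAlgebra H where
  toStarSubalgebra := StarSubalgebra.centralizer ℂ (Set.range (fibreProj b f hf))
  centralizer_centralizer' := by simp

theorem mem_blockAlgebra {T : H →L[ℂ] H} :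
    T ∈ blockAlgebra b f hf ↔ ∀ i j, f i ≠ f j → ⟪b i, T (b j)⟫_ℂ = 0 := by
  change T ∈ StarSubalgebra.centralizer ℂ (Set.range (fibreProj b f hf)) ↔ _
  rw [StarSubalgebra.mem_centralizer_iff]
  constructor
  · intro h i j hij
    have h1 := congrArg (fun S : H →L[ℂ] H => ⟪b i, S (b j)⟫_ℂ) (h _ ⟨f j, rfl⟩).1
    change ⟪b i, fibreProj b f hf (f j) (T (b j))⟫_ℂ =
      ⟪b i, T (fibreProj b f hf (f j) (b j))⟫_ℂ at h1
    rw [inner_basis_fibreProj, fibreProj_basis, if_neg hij, if_pos rfl] at h1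
    exact h1.symm
  · rintro h _ ⟨k, rfl⟩
    rw [star_fibreProj, and_self]
    refine ext_basis b fun j => ext_inner_basis b fun i => ?_
    change ⟪b i, fibreProj b f hf k (T (b j))⟫_ℂ = ⟪b i, T (fibreProj b f hf k (b j))⟫_ℂ
    rw [inner_basis_fibreProj, fibreProj_basis]
    by_cases hij : f i = f j
    · rw [hij]; split_ifs <;> simp
    · have := h i j hij
      split_ifs <;> simp [this]

theorem rankOne_mem_blockAlgebra {i j : ℕ} (h : f i = f j) :
    InnerProductSpace.rankOne ℂ (b i) (b j) ∈ blockAlgebra b f hf := by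
  rw [mem_blockAlgebra]
  intro k l hkl
  rw [InnerProductSpace.rankOne_apply, inner_smul_right, inner_basis, inner_basis]
  split_ifs with h1 h2 <;> simp_all

/-- The blocks of `f` below `n`, all other indices being put into blocks of size one. -/
def truncBlocks (f : ℕ → ℕ) (n i : ℕ) : ℕ := if i < n then f i else i

theorem truncBlocks_eq_iff (hle : ∀ i, f i ≤ i) (n i j : ℕ) :
    truncBlocks f n i = truncBlocks f n j ↔ i = j ∨ (i < n ∧ j < n ∧ f i = f j) := by
  have h1 := hle i
  have h2 := hle j
  unfold truncBlocks
  split_ifs with hi hj <;> constructor <;> intro h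
  · exact Or.inr ⟨hi, hj, h⟩
  · rcases h with rfl | ⟨-, -, h⟩ <;> [rfl; exact h]
  all_goals omega

theorem finite_fibre_truncBlocks (n k : ℕ) :
    (truncBlocks f n ⁻¹' {k}).Finite := by
  refine ((Set.finite_Iio n).union (Set.finite_singleton k)).subset fun i hi => ?_
  rcases lt_or_ge i n with h | h
  · exact Or.inl h
  · right
    simpa [truncBlocks, h.not_gt] using hi

theorem apply_basis_eq_sum {T : H →L[ℂ] H} (hT : T ∈ blockAlgebra b f hf) (j : ℕ) :
    T (b j) = ∑ i ∈ (hf (f j)).toFinset, ⟪b i, T (b j)⟫_ℂ • b i := by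
  rw [mem_blockAlgebra] at hT
  refine ext_inner_basis b fun i => ?_
  simp only [inner_sum, inner_smul_right, inner_basis, mul_ite, mul_one, mul_zero]
  rw [Finset.sum_ite_eq]
  split_ifs with h
  · rfl
  · exact hT i j fun hij => h (by simpa using hij)

/-- The filtration of the block algebra of `f` whose `n`-th term consists of the operators which are
diagonal outside the first `n` basis vectors. -/
noncomputable def blockFiltration (hle : ∀ i, f i ≤ i) : Filtration (blockAlgebra b f hf) where
  alg n := blockAlgebra b (truncBlocks f n) (finite_fibre_truncBlocks n)
  mono n T hT := by
    rw [mem_blockAlgebra] at hT ⊢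
    refine fun i j hij => hT i j fun h => hij ?_
    rw [truncBlocks_eq_iff hle] at h ⊢
    omega
  le n T hT := by
    rw [mem_blockAlgebra] at hT ⊢
    refine fun i j hij => hT i j fun h => hij ?_
    rw [truncBlocks_eq_iff hle] at h
    rcases h with rfl | ⟨-, -, h⟩ <;> [rfl; exact h]
  generates := by
    refine subset_antisymm ?_ ?_
    · rw [← (blockAlgebra b f hf).centralizer_centralizer]
      refine Set.centralizer_subset (Set.centralizer_subset (Set.iUnion_subset fun n T hT => ?_))
      rw [SetLike.mem_coe, mem_blockAlgebra] at hT ⊢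
      refine fun i j hij => hT i j fun h => hij ?_
      rw [truncBlocks_eq_iff hle] at h
      rcases h with rfl | ⟨-, -, h⟩ <;> [rfl; exact h]
    · -- An operator commuting with all matrix units of the blocks commutes with block diagonal ones.
      intro T hT S hS
      have hunit : ∀ i j, f i = f j → ∀ x, ⟪b j, S x⟫_ℂ • b i = ⟪b j, x⟫_ℂ • S (b i) := by
        intro i j hij x
        have h := hS (InnerProductSpace.rankOne ℂ (b i) (b j)) (Set.mem_iUnion.2
          ⟨max i j + 1, rankOne_mem_blockAlgebra b _ (by
            rw [truncBlocks_eq_iff hle]; exact Or.inr ⟨by omega, by omega, hij⟩)⟩)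
        simpa using congrArg (fun R : H →L[ℂ] H => R x) h
      refine ext_basis b fun j => ?_
      change S (T (b j)) = T (S (b j))
      have hSj : S (b j) = ⟪b j, S (b j)⟫_ℂ • b j := by
        rw [hunit j j rfl, inner_basis, if_pos rfl, one_smul]
      rw [hSj, map_smul, apply_basis_eq_sum b hf hT j, map_sum, Finset.smul_sum]
      refine Finset.sum_congr rfl fun i hi => ?_
      have hij : f i = f j := by simpa using hi
      have := hunit i j hij (b j)
      rw [inner_basis, if_pos rfl, one_smul] at this
      rw [map_smul, ← this, smul_comm]

end BlockAlgebra

/-! ### The trace and the matrix units of the block algebra -/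

section BlockTrace

variable {H : Type*} [NormedAddCommGroup H] [InnerProductSpace ℂ H]
  (b : HilbertBasis ℕ ℂ H)

theorem hasSum_normSq_inner_basis (x : H) : HasSum (fun i => ‖⟪b i, x⟫_ℂ‖ ^ 2) (‖x‖ ^ 2) := by
  have h := b.hasSum_inner_mul_inner x x
  rw [inner_self_eq_norm_sq_to_K] at h
  have e : (fun i => ⟪x, b i⟫_ℂ * ⟪b i, x⟫_ℂ) = fun i => ((‖⟪b i, x⟫_ℂ‖ ^ 2 : ℝ) : ℂ) :=
    funext fun i => by
      rw [← inner_conj_symm x (b i), ← Complex.normSq_eq_conj_mul_self,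
        Complex.normSq_eq_norm_sq]
  rw [e] at h
  have h' := Complex.hasSum_re h
  have h2 : (((‖x‖ : ℂ)) ^ 2).re = ‖x‖ ^ 2 := by rw [← Complex.ofReal_pow, Complex.ofReal_re]
  exact h2 ▸ h'

theorem norm_inner_basis_le (T : H →L[ℂ] H) (i : ℕ) : ‖⟪b i, T (b i)⟫_ℂ‖ ≤ ‖T‖ := by
  have hb := b.orthonormal.1 i
  have h := (norm_inner_le_norm (𝕜 := ℂ) (b i) (T (b i))).trans
    (mul_le_mul_of_nonneg_left (T.le_opNorm (b i)) (norm_nonneg _))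
  simpa [hb] using h

variable {w : ℕ → ℝ}

theorem summable_weighted_diag (hw : ∀ i, 0 < w i) (hw1 : HasSum w 1) (T : H →L[ℂ] H) :
    Summable fun i => (w i : ℂ) * ⟪b i, T (b i)⟫_ℂ := by
  refine Summable.of_norm_bounded (hw1.summable.mul_right ‖T‖) fun i => ?_
  rw [norm_mul, Complex.norm_real, Real.norm_of_nonneg (hw i).le]
  exact mul_le_mul_of_nonneg_left (norm_inner_basis_le b T i) (hw i).le

theorem re_weighted_diag (hw : ∀ i, 0 < w i) (hw1 : HasSum w 1) (T : H →L[ℂ] H) :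
    HasSum (fun i => w i * (⟪b i, T (b i)⟫_ℂ).re)
      (∑' i, (w i : ℂ) * ⟪b i, T (b i)⟫_ℂ).re := by
  have h := Complex.hasSum_re (summable_weighted_diag b hw hw1 T).hasSum
  simpa only [Complex.re_ofReal_mul] using h

theorem weighted_diag_nonneg (hw : ∀ i, 0 < w i) {T : H →L[ℂ] H} (hT : 0 ≤ T) :
    0 ≤ ∑' i, (w i : ℂ) * ⟪b i, T (b i)⟫_ℂ :=
  tsum_nonneg fun i => mul_nonneg (by exact_mod_cast (hw i).le)
    (((ContinuousLinearMap.nonneg_iff_isPositive T).1 hT).inner_nonneg_right _)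

variable [CompleteSpace H] {f : ℕ → ℕ} (hf : ∀ k, (f ⁻¹' {k}).Finite)

theorem weighted_diag_mul_comm (hw : ∀ i, 0 < w i) (hw1 : HasSum w 1)
    (hwf : ∀ i j, f i = f j → w i = w j) {S T : H →L[ℂ] H} (hT : T ∈ blockAlgebra b f hf) :
    ∑' i, (w i : ℂ) * ⟪b i, (T * S) (b i)⟫_ℂ = ∑' i, (w i : ℂ) * ⟪b i, (S * T) (b i)⟫_ℂ := by
  have hin : ∀ (S T : H →L[ℂ] H) i, HasSum (fun j => ⟪b i, T (b j)⟫_ℂ * ⟪b j, S (b i)⟫_ℂ)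
      ⟪b i, (T * S) (b i)⟫_ℂ := fun S T i => by
    have h := b.hasSum_inner_mul_inner (ContinuousLinearMap.adjoint T (b i)) (S (b i))
    simp only [ContinuousLinearMap.adjoint_inner_left] at h
    exact h
  set F : ℕ → ℕ → ℂ := fun i j => (w i : ℂ) * (⟪b i, T (b j)⟫_ℂ * ⟪b j, S (b i)⟫_ℂ) with hF
  set T' := ContinuousLinearMap.adjoint T with hT'
  have hdom : ∀ i, HasSum (fun j => w i * (‖⟪b j, T' (b i)⟫_ℂ‖ ^ 2 + ‖⟪b j, S (b i)⟫_ℂ‖ ^ 2))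
      (w i * (‖T' (b i)‖ ^ 2 + ‖S (b i)‖ ^ 2)) := fun i =>
    ((hasSum_normSq_inner_basis b _).add (hasSum_normSq_inner_basis b _)).mul_left _
  have hnn : ∀ i j, 0 ≤ w i * (‖⟪b j, T' (b i)⟫_ℂ‖ ^ 2 + ‖⟪b j, S (b i)⟫_ℂ‖ ^ 2) := fun i j => by
    have := hw i
    positivity
  have hsum : Summable fun p : ℕ × ℕ =>
      w p.1 * (‖⟪b p.2, T' (b p.1)⟫_ℂ‖ ^ 2 + ‖⟪b p.2, S (b p.1)⟫_ℂ‖ ^ 2) := by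
    rw [summable_prod_of_nonneg fun p => hnn p.1 p.2]
    refine ⟨fun i => (hdom i).summable, ?_⟩
    simp only [(hdom _).tsum_eq]
    refine Summable.of_nonneg_of_le (fun i => ?_) (fun i => ?_)
      (hw1.summable.mul_right (‖T'‖ ^ 2 + ‖S‖ ^ 2))
    · have := hw i
      positivity
    · have hb := b.orthonormal.1 i
      have h1 := T'.le_opNorm (b i)
      have h2 := S.le_opNorm (b i)
      rw [hb, mul_one] at h1 h2
      have := (hw i).le
      gcongr
  have hFs : Summable (Function.uncurry F) := by
    refine Summable.of_norm_bounded hsum fun p => ?_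
    have e : ‖⟪b p.1, T (b p.2)⟫_ℂ‖ = ‖⟪b p.2, T' (b p.1)⟫_ℂ‖ := by
      rw [hT', ContinuousLinearMap.adjoint_inner_right, norm_inner_symm]
    simp only [Function.uncurry, hF]
    rw [norm_mul, norm_mul, Complex.norm_real, Real.norm_of_nonneg (hw _).le, e]
    refine mul_le_mul_of_nonneg_left ?_ (hw _).le
    nlinarith [sq_nonneg (‖⟪b p.2, T' (b p.1)⟫_ℂ‖ - ‖⟪b p.2, S (b p.1)⟫_ℂ‖),
      sq_nonneg (‖⟪b p.2, T' (b p.1)⟫_ℂ‖), sq_nonneg (‖⟪b p.2, S (b p.1)⟫_ℂ‖)]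
  calc ∑' i, (w i : ℂ) * ⟪b i, (T * S) (b i)⟫_ℂ = ∑' i, ∑' j, F i j :=
        tsum_congr fun i => ((hin S T i).mul_left _).tsum_eq.symm
    _ = ∑' j, ∑' i, F i j := hFs.tsum_comm.symm
    _ = ∑' j, (w j : ℂ) * ⟪b j, (S * T) (b j)⟫_ℂ := tsum_congr fun j => by
        rw [← ((hin T S j).mul_left (w j : ℂ)).tsum_eq]
        refine tsum_congr fun i => ?_
        -- the weights agree wherever the entry of the block diagonal operator `T` is nonzero
        by_cases hij : f i = f j
        · simp only [hF]
          rw [hwf i j hij, mul_comm ⟪b j, S (b i)⟫_ℂ]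
        · simp [hF, (mem_blockAlgebra b hf).1 hT i j hij]

/-- The trace `T ↦ ∑ wᵢ Tᵢᵢ` on the block algebra, for weights which are constant on the blocks. -/
noncomputable def blockTrace (hw : ∀ i, 0 < w i) (hw1 : HasSum w 1)
    (hwf : ∀ i j, f i = f j → w i = w j) : NormalTrace (blockAlgebra b f hf) where
  tr := PositiveLinearMap.mk₀
    { toFun := fun T => ∑' i, (w i : ℂ) * ⟪b i, (T : H →L[ℂ] H) (b i)⟫_ℂ
      map_add' := fun S T => by
        rw [← (summable_weighted_diag b hw hw1 (S : H →L[ℂ] H)).tsum_add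
          (summable_weighted_diag b hw hw1 (T : H →L[ℂ] H))]
        refine tsum_congr fun i => ?_
        rw [← mul_add, ← inner_add_right]
        rfl
      map_smul' := fun c T => by
        rw [RingHom.id_apply, smul_eq_mul, ← tsum_mul_left]
        refine tsum_congr fun i => ?_
        rw [mul_left_comm, ← inner_smul_right _ _ c]
        rfl }
    fun T hT => weighted_diag_nonneg b hw (T := T) hT
  tr_one := by
    have h : ∀ i, (w i : ℂ) * ⟪b i, ((1 : blockAlgebra b f hf) : H →L[ℂ] H) (b i)⟫_ℂ = w i :=
      fun i => by
        change (w i : ℂ) * ⟪b i, b i⟫_ℂ = w i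
        rw [inner_basis, if_pos rfl, mul_one]
    refine (tsum_congr h).trans ?_
    exact_mod_cast hw1.tsum_eq
  tr_mul_comm S T := weighted_diag_mul_comm b hf hw hw1 hwf S.2
  faithful T hT := by
    have h := re_weighted_diag b hw hw1 ((star T * T : blockAlgebra b f hf) : H →L[ℂ] H)
    change ∑' i, (w i : ℂ) * ⟪b i, ((star T * T : blockAlgebra b f hf) : H →L[ℂ] H) (b i)⟫_ℂ = 0
      at hT
    have e : ∀ i, w i * (⟪b i, ((star T * T : blockAlgebra b f hf) : H →L[ℂ] H) (b i)⟫_ℂ).re =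
        w i * ‖(T : H →L[ℂ] H) (b i)‖ ^ 2 := fun i => by
      change w i * (⟪b i, ContinuousLinearMap.adjoint (T : H →L[ℂ] H)
        ((T : H →L[ℂ] H) (b i))⟫_ℂ).re = _
      rw [ContinuousLinearMap.adjoint_inner_right, inner_self_eq_norm_sq_to_K]
      norm_cast
    rw [hT, Complex.zero_re, funext e,
      hasSum_zero_iff_of_nonneg fun i => by have := hw i; positivity] at h
    refine Subtype.ext (ext_basis b fun j => ?_)
    have h1 := congrFun h j
    simpa [(hw j).ne'] using h1
  normal S s hne hdir hpos hs := by
    have hre := fun T : blockAlgebra b f hf => re_weighted_diag b hw hw1 (T : H →L[ℂ] H)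
    have hmono : ∀ {a a' : blockAlgebra b f hf}, a ≤ a' → ∀ i,
        w i * (⟪b i, (a : H →L[ℂ] H) (b i)⟫_ℂ).re ≤ w i * (⟪b i, (a' : H →L[ℂ] H) (b i)⟫_ℂ).re :=
      fun {a a'} h i => mul_le_mul_of_nonneg_left
        (re_inner_mono (a := (a : H →L[ℂ] H)) (b := (a' : H →L[ℂ] H)) h _) (hw i).le
    have hnn : ∀ a ∈ S, ∀ i, 0 ≤ w i * (⟪b i, (a : H →L[ℂ] H) (b i)⟫_ℂ).re := fun a ha i => by
      simpa using hmono (hpos a ha) i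
    refine ⟨?_, fun u hu => ?_⟩
    · rintro _ ⟨a, ha, rfl⟩
      exact hasSum_le (hmono (hs.1 ha)) (hre a) (hre s)
    · -- The finite partial sums of the trace are controlled by the normality of vector states.
      refine hasSum_le_of_sum_le (hre s) fun I => ?_
      refine le_of_forall_pos_le_add fun ε hε => ?_
      have hI : ∀ J : Finset ℕ, ∃ a ∈ S, ∀ i ∈ J,
          (⟪b i, (s : H →L[ℂ] H) (b i)⟫_ℂ).re ≤ (⟪b i, (a : H →L[ℂ] H) (b i)⟫_ℂ).re + ε := by
        intro J
        induction J using Finset.induction_on with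
        | empty => obtain ⟨a, ha⟩ := hne; exact ⟨a, ha, by simp⟩
        | insert j J _ ih =>
          obtain ⟨a, ha, h1⟩ := ih
          obtain ⟨a', ha', h2⟩ : ∃ a' ∈ S, (⟪b j, (s : H →L[ℂ] H) (b j)⟫_ℂ).re ≤
              (⟪b j, (a' : H →L[ℂ] H) (b j)⟫_ℂ).re + ε := by
            by_contra! hcon
            have := le_of_isLUB_of_re_inner_le hne hdir hpos hs (b j)
              (u := (⟪b j, (s : H →L[ℂ] H) (b j)⟫_ℂ).re - ε) fun a ha => by
                linarith [hcon a ha]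
            linarith
          obtain ⟨c, hc, hac, hac'⟩ := hdir a ha a' ha'
          refine ⟨c, hc, fun i hi => ?_⟩
          rcases Finset.mem_insert.1 hi with rfl | hi
          · linarith [re_inner_mono (a := (a' : H →L[ℂ] H)) (b := (c : H →L[ℂ] H)) hac' (b i)]
          · linarith [h1 i hi,
              re_inner_mono (a := (a : H →L[ℂ] H)) (b := (c : H →L[ℂ] H)) hac (b i)]
      obtain ⟨a, ha, h⟩ := hI I
      have h1 : ∑ i ∈ I, w i * (⟪b i, (s : H →L[ℂ] H) (b i)⟫_ℂ).re ≤
          ∑ i ∈ I, w i * (⟪b i, (a : H →L[ℂ] H) (b i)⟫_ℂ).re + (∑ i ∈ I, w i) * ε := by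
        rw [Finset.sum_mul, ← Finset.sum_add_distrib]
        refine Finset.sum_le_sum fun i hi => ?_
        rw [← mul_add]
        exact mul_le_mul_of_nonneg_left (h i hi) (hw i).le
      have h2 : ∑ i ∈ I, w i ≤ 1 := sum_le_hasSum _ (fun i _ => (hw i).le) hw1
      have h3 := (sum_le_hasSum I (fun i _ => hnn a ha i) (hre a)).trans
        (hu ⟨a, ha, rfl⟩)
      nlinarith

theorem blockTrace_apply (hw : ∀ i, 0 < w i) (hw1 : HasSum w 1)
    (hwf : ∀ i j, f i = f j → w i = w j) (T : blockAlgebra b f hf) :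
    (blockTrace b hf hw hw1 hwf).tr T = ∑' i, (w i : ℂ) * ⟪b i, (T : H →L[ℂ] H) (b i)⟫_ℂ := rfl

/-- The matrix unit `eᵢⱼ` of the block algebra, for indices `i` and `j` in the same block. -/
noncomputable def matUnit (i j : ℕ) (h : f i = f j) : blockAlgebra b f hf :=
  ⟨InnerProductSpace.rankOne ℂ (b i) (b j), rankOne_mem_blockAlgebra b hf h⟩

theorem matUnit_apply {i j : ℕ} (h : f i = f j) (x : H) :
    (matUnit b hf i j h : H →L[ℂ] H) x = ⟪b j, x⟫_ℂ • b i := rfl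

theorem star_matUnit {i j : ℕ} (h : f i = f j) :
    star (matUnit b hf i j h) = matUnit b hf j i h.symm :=
  Subtype.ext (InnerProductSpace.adjoint_rankOne (b i) (b j))

theorem matUnit_mul_matUnit {i j k : ℕ} (h : f i = f j) (h' : f j = f k) :
    matUnit b hf i j h * matUnit b hf j k h' = matUnit b hf i k (h.trans h') := by
  refine Subtype.ext (ContinuousLinearMap.ext fun x => ?_)
  change ⟪b j, ⟪b k, x⟫_ℂ • b j⟫_ℂ • b i = ⟪b k, x⟫_ℂ • b i
  rw [inner_smul_right, inner_basis, if_pos rfl, mul_one]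

theorem matUnit_mul_matUnit_of_ne {i j k l : ℕ} (h : f i = f j) (h' : f k = f l) (hjk : j ≠ k) :
    matUnit b hf i j h * matUnit b hf k l h' = 0 := by
  refine Subtype.ext (ContinuousLinearMap.ext fun x => ?_)
  change ⟪b j, ⟪b l, x⟫_ℂ • b k⟫_ℂ • b i = 0
  simp [inner_basis, hjk]

theorem matUnit_self_nonneg (i : ℕ) : 0 ≤ matUnit b hf i i rfl := by
  have h := star_mul_self_nonneg (matUnit b hf i i rfl)
  rwa [star_matUnit, matUnit_mul_matUnit] at h

theorem blockTrace_matUnit_mul (hw : ∀ i, 0 < w i) (hw1 : HasSum w 1)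
    (hwf : ∀ i j, f i = f j → w i = w j) {i j : ℕ} (h : f i = f j) (T : blockAlgebra b f hf) :
    (blockTrace b hf hw hw1 hwf).tr (matUnit b hf i j h * T) =
      w i * ⟪b j, (T : H →L[ℂ] H) (b i)⟫_ℂ := by
  have e : ∀ k, (w k : ℂ) * ⟪b k, ((matUnit b hf i j h * T : blockAlgebra b f hf) :
      H →L[ℂ] H) (b k)⟫_ℂ = if k = i then w i * ⟪b j, (T : H →L[ℂ] H) (b i)⟫_ℂ else 0 := fun k => by
    change (w k : ℂ) * ⟪b k, ⟪b j, (T : H →L[ℂ] H) (b k)⟫_ℂ • b i⟫_ℂ = _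
    rw [inner_smul_right, inner_basis]
    split_ifs with hk
    · rw [hk, mul_one]
    · rw [mul_zero, mul_zero]
  rw [blockTrace_apply, tsum_congr e, tsum_ite_eq]

theorem blockTrace_matUnit_self (hw : ∀ i, 0 < w i) (hw1 : HasSum w 1)
    (hwf : ∀ i j, f i = f j → w i = w j) (i : ℕ) :
    (blockTrace b hf hw hw1 hwf).tr (matUnit b hf i i rfl) = w i := by
  rw [← mul_one (matUnit b hf i i rfl), blockTrace_matUnit_mul]
  change (w i : ℂ) * ⟪b i, b i⟫_ℂ = w i
  rw [inner_basis, if_pos rfl, mul_one]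

/-- A subfamily of the diagonal matrix units adds up to a projection. -/
theorem sum_matUnit_self_le_one {ι : Type*} [Fintype ι] {t : ι → ℕ} (ht : Function.Injective t) :
    ∑ i, matUnit b hf (t i) (t i) rfl ≤ 1 := by
  classical
  set p := ∑ i, matUnit b hf (t i) (t i) rfl with hp
  have hs : star p = p := by simp [hp, star_sum, star_matUnit]
  have hpp : p * p = p := by
    rw [hp, Finset.sum_mul_sum]
    refine Finset.sum_congr rfl fun i _ => ?_
    rw [Finset.sum_eq_single i, matUnit_mul_matUnit]
    · exact fun j _ hj => matUnit_mul_matUnit_of_ne b hf _ _ (ht.ne hj.symm)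
    · simp
  have h := star_mul_self_nonneg (1 - p)
  rw [star_sub, star_one, hs, mul_sub, sub_mul, sub_mul, hpp, mul_one, mul_one, one_mul,
    sub_self, sub_zero] at h
  exact sub_nonneg.1 h

end BlockTrace

/-! ### Martingales with one row in each block -/

namespace NormalTrace

variable {A : Type*} [CStarAlgebra A] [PartialOrder A] [StarOrderedRing A] (τ : NormalTrace A)

theorem toL1_zero : τ.toL1 0 = 0 := UniformSpace.Completion.coe_zero

theorem toL1_sub (x y : A) : τ.toL1 (x - y) = τ.toL1 x - τ.toL1 y :=
  UniformSpace.Completion.coe_sub _ _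

theorem squareNorm_zero : τ.squareNorm (fun _ => 0) = 0 := by
  unfold squareNorm
  simp only [← τ.toL1_zero, colNormL1_toL1]
  simp

end NormalTrace

section RowMartingale

variable {H : Type*} [NormedAddCommGroup H] [InnerProductSpace ℂ H] [CompleteSpace H]
  (b : HilbertBasis ℕ ℂ H) {f : ℕ → ℕ} (hf : ∀ k, (f ⁻¹' {k}).Finite) (hff : ∀ i, f (f i) = f i)

/-- The operator `∑_{i < n} cᵢ e_{f(i), i}`. When `f` picks an index in each block, its nonzero
entries lie in one row of each block. -/
noncomputable def rowSum (c : ℕ → ℝ) (n : ℕ) : blockAlgebra b f hf :=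
  ∑ i ∈ Finset.range n, (c i : ℂ) • matUnit b hf (f i) i (hff i)

theorem rowSum_succ (c : ℕ → ℝ) (n : ℕ) : rowSum b hf hff c (n + 1) =
    rowSum b hf hff c n + (c n : ℂ) • matUnit b hf (f n) n (hff n) :=
  Finset.sum_range_succ _ _

theorem rowSum_mem (hle : ∀ i, f i ≤ i) (c : ℕ → ℝ) (n : ℕ) :
    (rowSum b hf hff c n : H →L[ℂ] H) ∈ (blockFiltration b hf hle).alg n := by
  have e : (rowSum b hf hff c n : H →L[ℂ] H) = ∑ i ∈ Finset.range n,
      (c i : ℂ) • InnerProductSpace.rankOne ℂ (b (f i)) (b i) := by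
    rw [rowSum, AddSubmonoidClass.coe_finsetSum]
    rfl
  rw [e]
  refine sum_mem fun i hi => SMulMemClass.smul_mem _ (rankOne_mem_blockAlgebra b _ ?_)
  rw [Finset.mem_range] at hi
  rw [truncBlocks_eq_iff hle]
  exact Or.inr ⟨(hle i).trans_lt hi, hi, hff i⟩

variable {w : ℕ → ℝ} (hw : ∀ i, 0 < w i) (hw1 : HasSum w 1)
  (hwf : ∀ i j, f i = f j → w i = w j)

theorem isMartingale_rowSum (hle : ∀ i, f i ≤ i) {c : ℕ → ℝ} (hc : ∀ i, f i = i → c i = 0) :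
    IsMartingale (blockTrace b hf hw hw1 hwf) (blockFiltration b hf hle)
      fun n => (blockTrace b hf hw hw1 hwf).toL1 (rowSum b hf hff c n) := by
  refine fun n => ⟨subset_closure ⟨_, rowSum_mem b hf hff hle c n, rfl⟩, fun m hm => ?_⟩
  rw [NormalTrace.trMul_toL1, NormalTrace.trMul_toL1, rowSum_succ, add_mul, map_add,
    smul_mul_assoc, map_smul, blockTrace_matUnit_mul]
  by_cases h : f n = n
  · simp [hc n h]
  · have h0 := (mem_blockAlgebra b _).1 hm n (f n) (by
      rw [Ne, truncBlocks_eq_iff hle]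
      omega)
    rw [h0, mul_zero, smul_zero, add_zero]

theorem colNorm_le_of_rowSum {c s : ℕ → ℝ} (hs : ∀ k, 0 ≤ s k)
    (hcs : ∀ N k, ∑ i ∈ Finset.range N with f i = k, c i ^ 2 ≤ s k ^ 2)
    (hws : Summable fun k => w k * s k) (hle : ∀ i, f i ≤ i) (N : ℕ) :
    ((blockTrace b hf hw hw1 hwf).tr (CFC.sqrt (∑ i ∈ Finset.range N,
      ((c i ^ 2 : ℝ) : ℂ) • matUnit b hf (f i) (f i) rfl))).re ≤ ∑' k, w k * s k := by
  set q : ℕ → ℝ := fun k => ∑ i ∈ Finset.range N with f i = k, c i ^ 2 with hq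
  have hq0 : ∀ k, 0 ≤ q k := fun k => Finset.sum_nonneg fun i _ => sq_nonneg _
  set D := ∑ k ∈ Finset.range N, ((√(q k) : ℝ) : ℂ) • matUnit b hf k k rfl with hD
  have hD0 : 0 ≤ D := Finset.sum_nonneg fun k _ => by
    rw [Complex.coe_smul]
    exact smul_nonneg (Real.sqrt_nonneg _) (matUnit_self_nonneg b hf k)
  have hDD : D * D = ∑ i ∈ Finset.range N,
      ((c i ^ 2 : ℝ) : ℂ) • matUnit b hf (f i) (f i) rfl := by
    have h1 : D * D = ∑ k ∈ Finset.range N, (q k : ℂ) • matUnit b hf k k rfl := by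
      rw [hD, Finset.sum_mul_sum]
      refine Finset.sum_congr rfl fun k hk => ?_
      rw [Finset.sum_eq_single k]
      · rw [smul_mul_smul_comm, matUnit_mul_matUnit, ← Complex.ofReal_mul,
          Real.mul_self_sqrt (hq0 k)]
      · intro l _ hl
        rw [smul_mul_smul_comm, matUnit_mul_matUnit_of_ne b hf _ _ hl.symm, smul_zero]
      · exact fun h => absurd hk h
    rw [h1]
    refine (Finset.sum_congr rfl fun k _ => ?_).trans (Finset.sum_fiberwise_of_maps_to (g := f)
      (fun i hi => Finset.mem_range.2 ((hle i).trans_lt (Finset.mem_range.1 hi))) _)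
    rw [hq, Complex.ofReal_sum, Finset.sum_smul]
    refine Finset.sum_congr rfl fun i hi => ?_
    obtain rfl := (Finset.mem_filter.1 hi).2
    rfl
  rw [CFC.sqrt_unique hDD hD0, hD, map_sum, Complex.re_sum]
  refine le_trans (Finset.sum_le_sum fun k _ => ?_)
    (hws.sum_le_tsum (Finset.range N) fun k _ => mul_nonneg (hw k).le (hs k))
  rw [map_smul, blockTrace_matUnit_self, smul_eq_mul, ← Complex.ofReal_mul, Complex.ofReal_re,
    mul_comm]
  exact mul_le_mul_of_nonneg_left (Real.sqrt_le_iff.2 ⟨hs k, hcs N k⟩) (hw k).le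

/-- A martingale with one row in each block is in `H¹` when the `ℓ²`-norms of these rows are summable
for the weights: the square function of the adjoint differences is diagonal. -/
theorem rowSum_mem_H1 (hle : ∀ i, f i ≤ i) {c s : ℕ → ℝ} (hc : ∀ i, f i = i → c i = 0)
    (hs : ∀ k, 0 ≤ s k)
    (hcs : ∀ N k, ∑ i ∈ Finset.range N with f i = k, c i ^ 2 ≤ s k ^ 2)
    (hws : Summable fun k => w k * s k) :
    (fun n => (blockTrace b hf hw hw1 hwf).toL1 (rowSum b hf hff c n)) ∈
      H1 (blockTrace b hf hw hw1 hwf) (blockFiltration b hf hle) := by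
  set τ := blockTrace b hf hw hw1 hwf with hτ
  set x : ℕ → τ.L1 := fun n => τ.toL1 (rowSum b hf hff c n) with hxdef
  have hx : IsMartingale τ (blockFiltration b hf hle) x :=
    isMartingale_rowSum b hf hff hw hw1 hwf hle hc
  have h0 : IsMartingale τ (blockFiltration b hf hle) 0 := fun n =>
    ⟨subset_closure ⟨0, (blockFiltration b hf hle).alg n |>.toStarSubalgebra.zero_mem, τ.toL1_zero⟩,
      fun _ _ => rfl⟩
  refine ⟨hx, ?_⟩
  refine lt_of_le_of_lt (iInf_le_of_le 0 (iInf_le_of_le x (iInf_le_of_le h0 (iInf_le_of_le hx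
    (iInf_le_of_le (zero_add _).symm le_rfl))))) ?_
  have hd0 : diffSeq τ (0 : ℕ → τ.L1) = fun _ => 0 := by
    funext n
    cases n <;> simp [diffSeq]
  rw [hd0, τ.squareNorm_zero, zero_add]
  -- the adjoints of the martingale differences
  let e : ℕ → blockAlgebra b f hf := fun n => n.casesOn 0 fun i =>
    (c i : ℂ) • matUnit b hf i (f i) (hff i).symm
  have he : ∀ n, τ.starL1 (diffSeq τ x n) = τ.toL1 (e n) := by
    rintro (_ | n)
    · simp only [diffSeq, hxdef, rowSum, Finset.range_zero, Finset.sum_empty, τ.starL1_toL1, star_zero]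
      rfl
    · rw [diffSeq, hxdef, ← τ.toL1_sub, rowSum_succ, add_sub_cancel_left, τ.starL1_toL1, star_smul,
        star_matUnit, Complex.star_def, Complex.conj_ofReal]
  rw [show (fun n => τ.starL1 (diffSeq τ x n)) = fun n => τ.toL1 (e n) from funext he]
  refine lt_of_le_of_lt (iSup_le fun N => ENNReal.ofReal_le_ofReal (?_ : _ ≤ ∑' k, w k * s k))
    ENNReal.ofReal_lt_top
  rw [τ.colNormL1_toL1 fun i : Fin N => e i, Fin.sum_univ_eq_sum_range fun i => star (e i) * e i]
  rcases N with _ | N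
  · simpa using tsum_nonneg fun k => mul_nonneg (hw k).le (hs k)
  · rw [Finset.sum_range_succ']
    have h1 : star (e 0) * e 0 = 0 := by simp [e]
    have h2 : ∀ i, star (e (i + 1)) * e (i + 1) =
        ((c i ^ 2 : ℝ) : ℂ) • matUnit b hf (f i) (f i) rfl := fun i => by
      change star ((c i : ℂ) • matUnit b hf i (f i) (hff i).symm) *
        ((c i : ℂ) • matUnit b hf i (f i) (hff i).symm) = _
      rw [star_smul, star_matUnit, smul_mul_smul_comm, matUnit_mul_matUnit, Complex.star_def,
        Complex.conj_ofReal, ← Complex.ofReal_mul, sq]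
    simp only [h1, h2, add_zero]
    exact colNorm_le_of_rowSum b hf hw hw1 hwf hs hcs hws hle N

/-- The column `∑ᵢ vᵢ e_{tᵢ, k}` of a block. -/
noncomputable def colSum {n : ℕ} (k : ℕ) (t : Fin n → ℕ) (ht : ∀ i, f (t i) = f k)
    (v : Fin n → ℝ) : blockAlgebra b f hf :=
  ∑ i, (v i : ℂ) • matUnit b hf (t i) k (ht i)

theorem sum_colSum_mul_star_le_one {n : ℕ} (k : ℕ) {t : Fin n → ℕ} (ht : ∀ i, f (t i) = f k)
    (htm : StrictMono t) {V : Matrix (Fin n) (Fin n) ℝ} (hV : V * V.transpose = 1) :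
    ∑ j, colSum b hf k t ht (fun i => V i j) * star (colSum b hf k t ht fun i => V i j) ≤ 1 := by
  refine le_of_eq_of_le ?_ (sum_matUnit_self_le_one b hf htm.injective)
  have h : ∀ j, colSum b hf k t ht (fun i => V i j) * star (colSum b hf k t ht fun i => V i j) =
      ∑ i, ∑ i', ((V i j * V i' j : ℝ) : ℂ) •
        matUnit b hf (t i) (t i') ((ht i).trans (ht i').symm) := fun j => by
    simp only [colSum, star_sum, star_smul, star_matUnit, Finset.sum_mul_sum, Complex.star_def,
      Complex.conj_ofReal, smul_mul_smul_comm, matUnit_mul_matUnit, Complex.ofReal_mul]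
  simp only [h]
  rw [Finset.sum_comm]
  refine Finset.sum_congr rfl fun i _ => ?_
  rw [Finset.sum_comm, Finset.sum_eq_single i]
  · have h1 := congrFun (congrFun hV i) i
    rw [Matrix.mul_apply, Matrix.one_apply_eq] at h1
    simp only [Matrix.transpose_apply] at h1
    rw [← Finset.sum_smul, ← Complex.ofReal_sum, h1, Complex.ofReal_one, one_smul]
  · intro i' _ hi'
    have h1 := congrFun (congrFun hV i) i'
    rw [Matrix.mul_apply, Matrix.one_apply_ne hi'.symm] at h1
    simp only [Matrix.transpose_apply] at h1
    rw [← Finset.sum_smul, ← Complex.ofReal_sum, h1, Complex.ofReal_zero, zero_smul]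
  · simp

theorem tr_rowSum_mul_colSum {n : ℕ} {k : ℕ} (hk : f k = k) {t : Fin n → ℕ}
    (ht : ∀ i, f (t i) = f k) (htm : StrictMono t) (c : ℕ → ℝ) (v : Fin n → ℝ) (j : Fin n) :
    (blockTrace b hf hw hw1 hwf).tr (rowSum b hf hff c (t j) * colSum b hf k t ht v) =
      ((w k * ∑ i, if i < j then c (t i) * v i else 0 : ℝ) : ℂ) := by
  have h1 : ∀ l i, (blockTrace b hf hw hw1 hwf).tr
      (matUnit b hf (f l) l (hff l) * matUnit b hf (t i) k (ht i)) =
        if l = t i then (w k : ℂ) else 0 := fun l i => by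
    rw [blockTrace_matUnit_mul, matUnit_apply, inner_smul_right, inner_basis, inner_basis]
    by_cases h : l = t i
    · have : f l = k := by rw [h, ht, hk]
      rw [if_pos h, this]
      simp [h]
    · simp [h]
  rw [rowSum, colSum, Finset.sum_mul_sum, Finset.sum_comm, map_sum, Finset.mul_sum,
    Complex.ofReal_sum]
  refine Finset.sum_congr rfl fun i _ => ?_
  rw [map_sum]
  simp only [smul_mul_smul_comm, map_smul, h1, smul_eq_mul, mul_ite, mul_zero]
  rw [Finset.sum_ite_eq']
  simp only [Finset.mem_range, htm.lt_iff_lt]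
  split_ifs
  · push_cast; ring
  · simp

/-- If a martingale with one row in each block is in `H¹_max`, then it is a bounded functional of the
triangular truncations of orthogonal matrices whose row sums are proportional to its rows. -/
theorem exists_bound_of_mem_H1max (hle : ∀ i, f i ≤ i) {c : ℕ → ℝ}
    (h : (fun n => (blockTrace b hf hw hw1 hwf).toL1 (rowSum b hf hff c n)) ∈
      H1max (blockTrace b hf hw hw1 hwf) (blockFiltration b hf hle)) :
    ∃ K : ℝ, ∀ (n k : ℕ) (t : Fin n → ℕ) (V : Matrix (Fin n) (Fin n) ℝ) (μ : ℝ), f k = k →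
      (∀ i, f (t i) = f k) → StrictMono t → V * V.transpose = 1 →
      (∀ i, c (t i) = μ * ∑ l, V i l) → w k * (μ * triangularPairing V) ≤ K * √n := by
  set τ := blockTrace b hf hw hw1 hwf with hτ
  have h2 := h.2
  simp only [normH1max, iInf_lt_iff] at h2
  obtain ⟨x, z, y, ⟨C, hC⟩, hxy, -⟩ := h2
  refine ⟨C * (‖x‖ * ‖z‖), fun n k t V μ hk ht htm hV hc => ?_⟩
  have h3 := τ.sum_norm_trMul_le x z (fun j => y (t j))
    (fun j => colSum b hf k t ht fun i => V i j) C (fun j => hC ⟨t j, rfl⟩)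
    (sum_colSum_mul_star_le_one b hf k ht htm hV)
  have key : ∀ j, τ.tr (rowSum b hf hff c (t j) * colSum b hf k t ht fun i => V i j) =
      ((w k * ∑ i, if i < j then c (t i) * V i j else 0 : ℝ) : ℂ) := fun j =>
    tr_rowSum_mul_colSum b hf hff hw hw1 hwf hk ht htm c _ j
  simp only [← hxy, τ.trMul_toL1, key, Fintype.card_fin, Complex.norm_real] at h3
  have h4 : w k * (μ * triangularPairing V) =
      ∑ j, w k * ∑ i, if i < j then c (t i) * V i j else 0 := by
    rw [← Finset.mul_sum, triangularPairing, Finset.mul_sum]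
    congr 1
    refine Finset.sum_congr rfl fun j _ => ?_
    rw [Finset.mul_sum]
    refine Finset.sum_congr rfl fun i _ => ?_
    rw [hc]
    split_ifs <;> ring
  rw [h4]
  refine (Finset.sum_le_sum fun j _ => le_abs_self _).trans (h3.trans_eq ?_)
  ring

end RowMartingale

/-! ### A partition of the natural numbers into blocks of given sizes -/

section PairBlocks

/-- The partition of `ℕ` with the blocks `{pair k 0, …, pair k (N k)}`, all other blocks being of size
one; each index is sent to the least element of its block. -/
def pairBlock (N : ℕ → ℕ) (i : ℕ) : ℕ :=
  if i.unpair.2 ≤ N i.unpair.1 then Nat.pair i.unpair.1 0 else i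

/-- The greatest element of the block of `i`. -/
def pairBlockMax (N : ℕ → ℕ) (i : ℕ) : ℕ :=
  if i.unpair.2 ≤ N i.unpair.1 then Nat.pair i.unpair.1 (N i.unpair.1) else i

variable (N : ℕ → ℕ)

theorem pairBlock_pair {k l : ℕ} (h : l ≤ N k) : pairBlock N (Nat.pair k l) = Nat.pair k 0 := by
  simp [pairBlock, h]

theorem pairBlockMax_pair {k l : ℕ} (h : l ≤ N k) :
    pairBlockMax N (Nat.pair k l) = Nat.pair k (N k) := by
  simp [pairBlockMax, h]

theorem pair_le_pair_of_le (k : ℕ) {l m : ℕ} (h : l ≤ m) : Nat.pair k l ≤ Nat.pair k m := by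
  rcases h.eq_or_lt with rfl | h
  · exact le_rfl
  · exact (Nat.pair_lt_pair_right k h).le

theorem pairBlock_le (i : ℕ) : pairBlock N i ≤ i := by
  unfold pairBlock
  split_ifs
  · exact (pair_le_pair_of_le _ (Nat.zero_le _)).trans_eq (Nat.pair_unpair i)
  · exact le_rfl

theorem le_pairBlockMax (i : ℕ) : i ≤ pairBlockMax N i := by
  unfold pairBlockMax
  split_ifs with h
  · exact (Nat.pair_unpair i).symm.trans_le (pair_le_pair_of_le _ h)
  · exact le_rfl

theorem pairBlock_pairBlock (i : ℕ) : pairBlock N (pairBlock N i) = pairBlock N i := by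
  by_cases h : i.unpair.2 ≤ N i.unpair.1
  · have e : pairBlock N i = Nat.pair i.unpair.1 0 := if_pos h
    rw [e, pairBlock_pair N (Nat.zero_le _)]
  · have e : pairBlock N i = i := if_neg h
    rw [e, e]

theorem pairBlockMax_pairBlock (i : ℕ) : pairBlockMax N (pairBlock N i) = pairBlockMax N i := by
  by_cases h : i.unpair.2 ≤ N i.unpair.1
  · have e : pairBlock N i = Nat.pair i.unpair.1 0 := if_pos h
    rw [e, pairBlockMax_pair N (Nat.zero_le _)]
    exact (if_pos h).symm
  · have e : pairBlock N i = i := if_neg h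
    rw [e]

theorem finite_fibre_pairBlock (k : ℕ) : (pairBlock N ⁻¹' {k}).Finite := by
  refine (Set.finite_Iic (pairBlockMax N k)).subset fun i hi => ?_
  have hi' : pairBlock N i = k := hi
  rw [Set.mem_Iic, ← hi', pairBlockMax_pairBlock]
  exact le_pairBlockMax N i

/-- There are positive weights with sum `1` which are constant on the blocks. -/
theorem exists_pairBlock_weight : ∃ w : ℕ → ℝ, (∀ i, 0 < w i) ∧ HasSum w 1 ∧
    ∀ i j, pairBlock N i = pairBlock N j → w i = w j := by
  set v : ℕ → ℝ := fun i => (1 / 2) ^ pairBlockMax N i with hv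
  have hv0 : ∀ i, 0 < v i := fun i => by positivity
  have hvs : Summable v := Summable.of_nonneg_of_le (fun i => (hv0 i).le)
    (fun i => pow_le_pow_of_le_one (by norm_num) (by norm_num) (le_pairBlockMax N i))
    summable_geometric_two
  have hpos : 0 < ∑' i, v i := hvs.tsum_pos (fun i => (hv0 i).le) 0 (hv0 0)
  refine ⟨fun i => v i / ∑' i, v i, fun i => div_pos (hv0 i) hpos, ?_, fun i j h => ?_⟩
  · have := hvs.hasSum.div_const (∑' i, v i)
    rwa [div_self hpos.ne'] at this
  · simp only [hv]
    rw [← pairBlockMax_pairBlock N i, h, pairBlockMax_pairBlock]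

variable {N}

/-- Coefficients `c` which are `0` at the least element of each block and are given by `r` at the other
indices. -/
def pairCoeff (r : ∀ k, Fin (N k) → ℝ) (i : ℕ) : ℝ :=
  if h : 0 < i.unpair.2 ∧ i.unpair.2 ≤ N i.unpair.1 then
    r i.unpair.1 ⟨i.unpair.2 - 1, by omega⟩ else 0

theorem pairCoeff_pair (r : ∀ k, Fin (N k) → ℝ) (k : ℕ) (j : Fin (N k)) :
    pairCoeff r (Nat.pair k (j + 1)) = r k j := by
  have h : ∀ k' l, k' = k → l = (j : ℕ) + 1 → ∀ h : 0 < l ∧ l ≤ N k',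
      r k' ⟨l - 1, by omega⟩ = r k j := by
    rintro k' l rfl rfl h
    rfl
  have h1 : (Nat.pair k (j + 1)).unpair.1 = k := by simp
  have h2 : (Nat.pair k (j + 1)).unpair.2 = j + 1 := by simp
  unfold pairCoeff
  rw [dif_pos (by rw [h1, h2]; omega)]
  exact h _ _ h1 h2 (by rw [h1, h2]; omega)

theorem eq_pair_of_pairCoeff_ne_zero {r : ∀ k, Fin (N k) → ℝ} {i : ℕ} (h : pairCoeff r i ≠ 0) :
    ∃ k, ∃ j : Fin (N k), i = Nat.pair k (j + 1) := by
  unfold pairCoeff at h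
  split_ifs at h with h1
  · refine ⟨i.unpair.1, ⟨i.unpair.2 - 1, by omega⟩, ?_⟩
    rw [Nat.sub_add_cancel h1.1, Nat.pair_unpair]
  · exact absurd rfl h

theorem pairCoeff_eq_zero (r : ∀ k, Fin (N k) → ℝ) {i : ℕ} (hi : pairBlock N i = i) :
    pairCoeff r i = 0 := by
  by_contra h
  obtain ⟨k, j, rfl⟩ := eq_pair_of_pairCoeff_ne_zero h
  rw [pairBlock_pair N (by omega), Nat.pair_eq_pair] at hi
  omega

theorem sum_pairCoeff_sq_le {r : ∀ k, Fin (N k) → ℝ} {s : ℕ → ℝ}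
    (hs : ∀ k, ∑ j, r k j ^ 2 ≤ s (Nat.pair k 0) ^ 2) (n m : ℕ) :
    ∑ i ∈ Finset.range n with pairBlock N i = m, pairCoeff r i ^ 2 ≤ s m ^ 2 := by
  by_cases hm : m = Nat.pair m.unpair.1 0
  · set k := m.unpair.1 with hk
    rw [hm]
    refine le_trans ?_ (hs k)
    have hinj : Function.Injective fun j : Fin (N k) => Nat.pair k (j + 1) := fun i j h => by
      have := (Nat.pair_eq_pair.1 h).2
      exact Fin.ext (by omega)
    rw [← Finset.sum_filter_ne_zero]
    calc _ ≤ ∑ i ∈ Finset.univ.image fun j : Fin (N k) => Nat.pair k (j + 1),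
          pairCoeff r i ^ 2 := by
          refine Finset.sum_le_sum_of_subset_of_nonneg (fun i hi => ?_) fun _ _ _ => sq_nonneg _
          rw [Finset.mem_filter, Finset.mem_filter] at hi
          obtain ⟨⟨-, hi⟩, h0⟩ := hi
          obtain ⟨k', j, rfl⟩ := eq_pair_of_pairCoeff_ne_zero ((pow_ne_zero_iff two_ne_zero).1 h0)
          rw [pairBlock_pair N (by omega), Nat.pair_eq_pair] at hi
          obtain ⟨rfl, -⟩ := hi
          exact Finset.mem_image_of_mem (fun j : Fin (N k) => Nat.pair k (j + 1))
            (Finset.mem_univ j)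
      _ = ∑ j, r k j ^ 2 := by
          rw [Finset.sum_image hinj.injOn]
          simp only [pairCoeff_pair]
  · refine le_of_eq_of_le (Finset.sum_eq_zero fun i hi => ?_) (sq_nonneg _)
    by_contra h0
    obtain ⟨k', j, rfl⟩ := eq_pair_of_pairCoeff_ne_zero ((pow_ne_zero_iff two_ne_zero).1 h0)
    have hi := (Finset.mem_filter.1 hi).2
    rw [pairBlock_pair N (by omega)] at hi
    exact hm (by rw [← hi]; simp)

end PairBlocks

end NCMartingale

theorem corollary10 :
    ∃ (H : Type) (_ : NormedAddCommGroup H) (_ : InnerProductSpace ℂ H) (_ : CompleteSpace H)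
      (M : VonNeumannAlgebra H) (τ : NCMartingale.NormalTrace M) (F : NCMartingale.Filtration M),
      ¬ NCMartingale.H1 τ F ⊆ NCMartingale.H1max τ F := by
  open NCMartingale in
  choose N V hN hV hVK using fun k : ℕ => exists_triangularPairing_ge (k * 2 ^ Nat.pair k 0)
  obtain ⟨w, hw, hw1, hwf⟩ := exists_pairBlock_weight N
  let b : HilbertBasis ℕ ℂ (lp (fun _ : ℕ => ℂ) 2) := default
  let hf := finite_fibre_pairBlock N
  let hle := pairBlock_le N
  -- With this `μ` the `H¹`-norm of the `k`-th block is at most `2 ^ (-pair k 0)`, while by the choice of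
  -- `V k` a bound `K` for the truncation functional on this block is at least `k`.
  let μ : ℕ → ℝ := fun k => (1 / 2) ^ Nat.pair k 0 / (w (Nat.pair k 0) * √(N k))
  let s : ℕ → ℝ := fun m => (1 / 2) ^ m / w m
  let r : ∀ k, Fin (N k) → ℝ := fun k j => μ k * ∑ l, V k j l
  have hNpos : ∀ k, 0 < √(N k : ℝ) := fun k => Real.sqrt_pos.2 (by exact_mod_cast hN k)
  have hrs : ∀ k, ∑ j, r k j ^ 2 ≤ s (Nat.pair k 0) ^ 2 := fun k => by
    simp only [r, mul_pow]
    rw [← Finset.mul_sum, sum_sq_rowSum (hV k)]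
    have h1 := Real.sq_sqrt (Nat.cast_nonneg (N k) : (0 : ℝ) ≤ N k)
    have h2 : (N k : ℝ) ≠ 0 := by exact_mod_cast (hN k).ne'
    simp only [μ, s]
    rw [div_pow _ (w (Nat.pair k 0) * _), mul_pow, h1, div_mul_eq_mul_div, mul_div_mul_right _ _ h2,
      ← div_pow]
  refine ⟨_, inferInstance, inferInstance, inferInstance, blockAlgebra b _ hf,
    blockTrace b hf hw hw1 hwf, blockFiltration b hf hle, fun hsub => ?_⟩
  have hmem := hsub (rowSum_mem_H1 b hf (pairBlock_pairBlock N) hw hw1 hwf hle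
    (c := pairCoeff r) (s := s) (fun i hi => pairCoeff_eq_zero r hi)
    (fun m => (div_pos (by positivity) (hw m)).le) (sum_pairCoeff_sq_le hrs)
    (summable_geometric_two.congr fun m => (mul_div_cancel₀ _ (hw m).ne').symm))
  obtain ⟨K, hK⟩ := exists_bound_of_mem_H1max b hf (pairBlock_pairBlock N) hw hw1 hwf hle hmem
  obtain ⟨k, hk⟩ := exists_nat_gt K
  have h0 : pairBlock N (Nat.pair k 0) = Nat.pair k 0 := pairBlock_pair N (Nat.zero_le _)
  have h := hK (N k) (Nat.pair k 0) (fun j => Nat.pair k (j + 1)) (V k) (μ k) h0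
    (fun j => by rw [h0, pairBlock_pair N (by omega)])
    (fun i j hij => Nat.pair_lt_pair_right k (by simpa using hij)) (hV k)
    (fun j => pairCoeff_pair r k j)
  have hwk := hw (Nat.pair k 0)
  have hμ : w (Nat.pair k 0) * μ k = (1 / 2) ^ Nat.pair k 0 / √(N k) := by
    simp only [μ]
    field_simp
  have h1 : k * √(N k : ℝ) ≤ w (Nat.pair k 0) * (μ k * triangularPairing (V k)) := by
    rw [← mul_assoc, hμ]
    refine le_trans (le_of_eq ?_) (mul_le_mul_of_nonneg_left (hVK k)
      (div_nonneg (by positivity) (hNpos k).le))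
    have h2 := Real.sq_sqrt (Nat.cast_nonneg (N k) : (0 : ℝ) ≤ N k)
    have h3 := (hNpos k).ne'
    rw [one_div, inv_pow]
    field_simp
    rw [h2]
  exact absurd (lt_of_mul_lt_mul_right ((mul_lt_mul_of_pos_right hk (hNpos k)).trans_le
    (h1.trans h)) (hNpos k).le) (lt_irrefl _)
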